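/- Let $n$ be a positive integer and let $v\in\mathrm H^1(\mathbb R^n,dx)$ be a real-valued function with compact support. Let $d\gamma(y)=(2\pi)^{-n/2}e^{-|y|^2/2}\,dy$ on $\mathbb R^n$, and let $d\mu_d$ be the uniform probability measure on the unit sphere $\mathbb S^d\subset\mathbb R^{d+1}$. For an integer $d\ge n$, define $u_d$ on $\mathbb S^d$ by $$u_d(\omega)=v\big(\sqrt d\,\omega_1,\sqrt d\,\omega_2,\ldots,\sqrt d\,\omega_n\big),\qquad \omega=(\omega_1,\ldots,\omega_{d+1})\in\mathbb S^d.$$ For all $d$ large enough, $u_d\in\mathrm H^1(\mathbb S^d,d\mu_d)$, all entropy integrals below converge absolutely (with the convention $0\log(\cdot)=0$), and $$\lim_{d\to+\infty}\frac1d\left(\|\nabla u_d\|_{\mathrm L^2(\mathbb S^d,d\mu_d)}^2-\frac d2\int_{\mathbb S^d}|u_d|^2\log\left(\frac{|u_d|^2}{\|u_d\|_{\mathrm L^2(\mathbb S^d,d\mu_d)}^2}\right)d\mu_d\right)=\|\nabla v\|_{\mathrm L^2(\mathbb R^n,d\gamma)}^2-\frac12\int_{\mathbb R^n}|v|^2\log\left(\frac{|v|^2}{\|v\|_{\mathrm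 L^2(\mathbb R^n,d\gamma)}^2}\right)d\gamma .$$ Moreover, if $(p_d)_{d\ge3}$ is a sequence of real numbers such that $p_d\in(1,2)\cup\big(2,\tfrac{2d}{d-2}\big)$ for all $d\ge 3$ and $\lim_{d\to+\infty}p_d=2$, then $u_d\in\mathrm L^{p_d}(\mathbb S^d,d\mu_d)$ for all $d$ large enough, and $$\lim_{d\to+\infty}\frac1d\left(\|\nabla u_d\|_{\mathrm L^2(\mathbb S^d,d\mu_d)}^2-\frac d{2-p_d}\Big(\|u_d\|_{\mathrm L^2(\mathbb S^d,d\mu_d)}^2-\|u_d\|_{\mathrm L^{p_d}(\mathbb S^d,d\mu_d)}^2\Big)\right)=\|\nabla v\|_{\mathrm L^2(\mathbb R^n,d\gamma)}^2-\frac12\int_{\mathbb R^n}|v|^2\log\left(\frac{|v|^2}{\|v\|_{\mathrm L^2(\mathbb R^n,d\gamma)}^2}\right)d\gamma .$$ -/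

import Mathlib

open MeasureTheory Filter Topology
open scoped ENNReal ContDiff

noncomputable section

namespace GNSLimit

/-- The Euclidean space `ℝⁿ`. -/
abbrev Euc (n : ℕ) : Type := EuclideanSpace ℝ (Fin n)

/-- The unit sphere `S^d` in `ℝ^(d+1)`. -/
abbrev Sph (d : ℕ) : Type := Metric.sphere (0 : Euc (d + 1)) 1

/-! ### Sobolev functions on `ℝⁿ` -/

/-- `g` is the weak gradient of `v` on `ℝⁿ`: `∫ v ∂_w φ dx = - ∫ ⟨g, w⟩ φ dx` for every smooth
compactly supported `φ` and every direction `w`. -/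
def IsWeakGradient {n : ℕ} (v : Euc n → ℝ) (g : Euc n → Euc n) : Prop :=
  ∀ φ : Euc n → ℝ, ContDiff ℝ ∞ φ → HasCompactSupport φ → ∀ w : Euc n,
    ∫ x, v x * fderiv ℝ φ x w = -∫ x, inner ℝ (g x) w * φ x

/-- `v ∈ H¹(ℝⁿ, dx)`. -/
def MemH1 {n : ℕ} (v : Euc n → ℝ) : Prop :=
  MemLp v 2 volume ∧ ∃ g : Euc n → Euc n, MemLp g 2 volume ∧ IsWeakGradient v g

open Classical in
/-- The weak gradient of `v ∈ H¹(ℝⁿ, dx)` (unique almost everywhere); `0` if `v ∉ H¹`. -/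
def weakGradient {n : ℕ} (v : Euc n → ℝ) : Euc n → Euc n :=
  if h : ∃ g : Euc n → Euc n, MemLp g 2 volume ∧ IsWeakGradient v g then h.choose else 0

/-! ### The Gaussian measure -/

/-- The centred normalized Gaussian measure `dγ = (2π)^(-n/2) exp(-|y|²/2) dy` on `ℝⁿ`. -/
def gauss (n : ℕ) : Measure (Euc n) :=
  volume.withDensity fun y =>
    ENNReal.ofReal ((2 * Real.pi) ^ (-(n : ℝ) / 2) * Real.exp (-‖y‖ ^ 2 / 2))

/-! ### Sobolev functions on the sphere -/

/-- The uniform probability measure on `S^d`: the normalized surface measure. -/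
def unif (d : ℕ) : Measure (Sph d) :=
  ((volume : Measure (Euc (d + 1))).toSphere Set.univ)⁻¹ •
    (volume : Measure (Euc (d + 1))).toSphere

instance instIsProbabilityMeasureUnif (d : ℕ) : IsProbabilityMeasure (unif d) := by
  constructor
  rw [unif, Measure.smul_apply, smul_eq_mul]
  refine ENNReal.inv_mul_cancel ?_ (measure_ne_top _ _)
  rw [Ne, Measure.measure_univ_eq_zero]
  exact Measure.toSphere_ne_zero _

/-- The Riemannian divergence on `S^d`, at the point `ζ`, of a vector field `X` tangent to the
sphere and extended to a neighbourhood: the trace of `DX(ζ)` over the tangent space, that is, the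
full trace minus the contribution of the normal direction `ζ`. -/
def sphereDiv {d : ℕ} (X : Euc (d + 1) → Euc (d + 1)) (ζ : Sph d) : ℝ :=
  (∑ i, fderiv ℝ X (ζ : Euc (d + 1)) (EuclideanSpace.single i 1) i)
    - inner ℝ (fderiv ℝ X (ζ : Euc (d + 1)) (ζ : Euc (d + 1))) (ζ : Euc (d + 1))

/-- `G` is the weak (Riemannian) gradient of `u` on `S^d`: it is tangent to the sphere, and
`∫ ⟨G, X⟩ dμ_d = - ∫ u div X dμ_d` for every smooth tangent vector field `X` on `S^d`
(every such field is the restriction of a smooth field on `ℝ^(d+1)`). -/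
def IsSphereWeakGradient {d : ℕ} (u : Sph d → ℝ) (G : Sph d → Euc (d + 1)) : Prop :=
  (∀ᵐ ζ ∂(unif d), inner ℝ (G ζ) (ζ : Euc (d + 1)) = 0) ∧
  ∀ X : Euc (d + 1) → Euc (d + 1), ContDiff ℝ ∞ X →
    (∀ ζ : Sph d, inner ℝ (X ζ) (ζ : Euc (d + 1)) = 0) →
    ∫ ζ, inner ℝ (G ζ) (X ζ) ∂(unif d) = -∫ ζ, u ζ * sphereDiv X ζ ∂(unif d)

/-- `u ∈ H¹(S^d, dμ_d)`. -/
def MemSphereH1 {d : ℕ} (u : Sph d → ℝ) : Prop :=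
  MemLp u 2 (unif d) ∧
    ∃ G : Sph d → Euc (d + 1), MemLp G 2 (unif d) ∧ IsSphereWeakGradient u G

open Classical in
/-- The weak gradient of `u ∈ H¹(S^d, dμ_d)` (unique almost everywhere); `0` if `u ∉ H¹`. -/
def sphereWeakGradient {d : ℕ} (u : Sph d → ℝ) : Sph d → Euc (d + 1) :=
  if h : ∃ G : Sph d → Euc (d + 1), MemLp G 2 (unif d) ∧ IsSphereWeakGradient u G
  then h.choose else 0

/-! ### Entropies and deficits -/

/-- The integrand `|f|² log (|f|² / ‖f‖²_{L²(μ)})` of the entropy (with `0 log 0 = 0`). -/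
def entropyDensity {α : Type*} [MeasurableSpace α] (μ : Measure α) (f : α → ℝ) (x : α) : ℝ :=
  |f x| ^ 2 * Real.log (|f x| ^ 2 / lpNorm f 2 μ ^ 2)

/-- Deficit of the Gaussian logarithmic Sobolev inequality. -/
def gaussLSIDeficit {n : ℕ} (v : Euc n → ℝ) : ℝ :=
  lpNorm (weakGradient v) 2 (gauss n) ^ 2 - 1 / 2 * ∫ y, entropyDensity (gauss n) v y ∂(gauss n)

/-- Deficit of the logarithmic Sobolev inequality on `S^d`. -/
def sphereLSIDeficit {d : ℕ} (u : Sph d → ℝ) : ℝ :=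
  lpNorm (sphereWeakGradient u) 2 (unif d) ^ 2
    - (d : ℝ) / 2 * ∫ ζ, entropyDensity (unif d) u ζ ∂(unif d)

/-- Deficit of the Gagliardo-Nirenberg-Sobolev inequality on `S^d` with exponent `p ≠ 2`. -/
def sphereGNSDeficit {d : ℕ} (p : ℝ) (u : Sph d → ℝ) : ℝ :=
  lpNorm (sphereWeakGradient u) 2 (unif d) ^ 2
    - (d : ℝ) / (2 - p) * (lpNorm u 2 (unif d) ^ 2 - lpNorm u (ENNReal.ofReal p) (unif d) ^ 2)

/-- `u_d(ζ) = v(√d ζ₁, …, √d ζₙ)` on `S^d`. (Only `d ≥ n` matters; a coordinate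
that does not exist is read as `0`.) -/
def liftToSphere {n : ℕ} (v : Euc n → ℝ) (d : ℕ) (ζ : Sph d) : ℝ :=
  v (WithLp.toLp 2 fun i : Fin n =>
    if h : (i : ℕ) < d + 1 then Real.sqrt d * (ζ : Euc (d + 1)) ⟨i, h⟩ else 0)

end GNSLimit

end

/-! The proof rests on Poincaré's observation. For ζ uniform on S^d, the vector √d (ζ₁, …, ζₙ) has a
density proportional to (1 - |y|²/d)^((d-1-n)/2) on |y|² < d (`map_scaledCoords_unif`). This density
tends pointwise to the Gaussian one and is bounded uniformly in y and in large d. Integrals over S^d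
of functions of the first n coordinates thus become integrals over ℝⁿ, and they converge to Gaussian
integrals as soon as the integrands have a common Lebesgue-integrable majorant
(`tendsto_integral_unif`).

For the energy, the tangential gradient of u_d has squared norm d |∇v|² - ⟨∇v, y⟩². Divided by d,
the second term disappears in the limit, since y is bounded where ∇v ≠ 0. That this field is the
weak gradient is seen on mollifications of v, where the chain rule and the divergence theorem on the
sphere apply, and then by a limit at fixed d (`isSphereWeakGradient_liftGradient`).

For the entropy, a Sobolev inequality gives v ∈ L^q for some q > 2 (`exists_memLp_gt_two`). With
compact support, C (1 + |v|^q) on a ball is an integrable majorant both for |v|² log |v| and for the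
quotients (|v|^p - |v|²)/(p - 2) with p near 2. Writing ∫ |u_d|^p = M + (p - 2) b with M = ‖u_d‖₂²,
one has M → ‖v‖² and b → ∫ |v|² log |v| dγ. Strict differentiability of (x, p) ↦ x^(2/p) at (‖v‖²,
2) then turns the difference of norms divided by 2 - p into half the entropy
(`tendsto_sub_rpow_div`). -/

noncomputable section

namespace GNSLimit

/-! ### Polar coordinates and the law of the first coordinates on the sphere -/

section Polar

variable {E : Type*} [NormedAddCommGroup E] [NormedSpace ℝ E] [FiniteDimensional ℝ E]
  [MeasurableSpace E] [BorelSpace E] [Nontrivial E] (μ : Measure E) [μ.IsAddHaarMeasure]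

/-- Integration in polar coordinates. -/
theorem lintegral_eq_lintegral_sphere_prod {f : E → ℝ≥0∞} (hf : Measurable f) :
    ∫⁻ x, f x ∂μ = ∫⁻ ζ, ∫⁻ r : Set.Ioi (0 : ℝ), f ((r : ℝ) • (ζ : E))
      ∂(Measure.volumeIoiPow (Module.finrank ℝ E - 1)) ∂μ.toSphere := by
  have hg : Measurable fun p : Metric.sphere (0 : E) 1 × Set.Ioi (0 : ℝ) =>
      f ((p.2 : ℝ) • (p.1 : E)) := by fun_prop
  rw [← lintegral_prod _ hg.aemeasurable,
    ← μ.measurePreserving_homeomorphUnitSphereProd.lintegral_comp hg,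
    ← setLIntegral_univ f, ← setLIntegral_congr
      (ae_eq_univ.2 (by simp) : ({(0 : E)}ᶜ : Set E) =ᵐ[μ] Set.univ),
    ← lintegral_subtype_comap (measurableSet_singleton _).compl]
  refine lintegral_congr fun x => ?_
  have hx : ‖(x : E)‖ ≠ 0 := norm_ne_zero_iff.2 x.2
  simp [smul_smul, hx]

theorem lintegral_volumeIoiPow (k : ℕ) {g : ℝ → ℝ≥0∞} (hg : Measurable g) :
    ∫⁻ r : Set.Ioi (0 : ℝ), g r ∂(Measure.volumeIoiPow k) =
      ∫⁻ r in Set.Ioi 0, ENNReal.ofReal (r ^ k) * g r := by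
  rw [Measure.volumeIoiPow, lintegral_withDensity_eq_lintegral_mul _ (by fun_prop) (by fun_prop)]
  exact lintegral_subtype_comap measurableSet_Ioi fun r => ENNReal.ofReal (r ^ k) * g r

theorem lintegral_norm_eq_lintegral_Ioi {g : ℝ → ℝ≥0∞} (hg : Measurable g) :
    ∫⁻ x, g ‖x‖ ∂μ = (∫⁻ r in Set.Ioi 0, ENNReal.ofReal (r ^ (Module.finrank ℝ E - 1)) * g r) *
      μ.toSphere Set.univ := by
  rw [lintegral_eq_lintegral_sphere_prod μ (by fun_prop : Measurable fun x : E => g ‖x‖),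
    ← lintegral_volumeIoiPow _ hg, ← lintegral_const]
  refine lintegral_congr fun ζ => lintegral_congr fun r => ?_
  simp [norm_smul, abs_of_pos r.2.out]

end Polar

theorem exists_measurePreserving_split {d n m : ℕ} (h : d + 1 = n + m) :
    ∃ Φ : Euc (d + 1) → Euc n × Euc m, MeasurePreserving Φ volume volume ∧
      (∀ x i, (Φ x).1 i = x (Fin.cast h.symm (Fin.castAdd m i))) ∧
      ∀ x, ‖x‖ ^ 2 = ‖(Φ x).1‖ ^ 2 + ‖(Φ x).2‖ ^ 2 := by
  let e : Fin (d + 1) ≃ Fin n ⊕ Fin m := (finCongr h).trans finSumFinEquiv.symm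
  let Ψ : Euc (d + 1) ≃ₗᵢ[ℝ] WithLp 2 (Euc n × Euc m) :=
    (LinearIsometryEquiv.piLpCongrLeft 2 ℝ ℝ e).trans
      (PiLp.sumPiLpEquivProdLpPiLp 2 (fun _ => ℝ))
  refine ⟨fun x => WithLp.ofLp (Ψ x),
    (WithLp.volume_preserving_ofLp _ _).comp Ψ.measurePreserving, fun x i => ?_, fun x => ?_⟩
  · simp [Ψ, e, LinearIsometryEquiv.piLpCongrLeft]
  · rw [← Ψ.norm_map x, WithLp.prod_norm_sq_eq_of_L2]
    rfl

/-- Substitution s = √(r² - a²). With a = |y| and s = |z|, it replaces the radius of z by the radius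
r of the pair (y, z). -/
theorem lintegral_Ioi_comp_sqrt {a : ℝ} (ha : 0 ≤ a) (g : ℝ → ℝ≥0∞) :
    ∫⁻ s in Set.Ioi 0, g s = ∫⁻ r in Set.Ioi a,
      ENNReal.ofReal (r / √(r ^ 2 - a ^ 2)) * g (√(r ^ 2 - a ^ 2)) := by
  have him : (fun r : ℝ => √(r ^ 2 - a ^ 2)) '' Set.Ioi a = Set.Ioi 0 := by
    ext s
    constructor
    · rintro ⟨r, hr, rfl⟩
      exact Real.sqrt_pos.2 (by have : a < r := hr; nlinarith)
    · intro hs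
      have hs : 0 < s := hs
      refine ⟨√(s ^ 2 + a ^ 2), ?_, ?_⟩
      · exact Real.lt_sqrt_of_sq_lt (by nlinarith [sq_nonneg s, pow_pos hs 2])
      · change √(√(s ^ 2 + a ^ 2) ^ 2 - a ^ 2) = s
        rw [Real.sq_sqrt (by positivity), add_sub_cancel_right, Real.sqrt_sq hs.le]
  have hpos : ∀ r ∈ Set.Ioi a, 0 < r ^ 2 - a ^ 2 := fun r hr => by
    have : a < r := hr; nlinarith
  rw [← him, lintegral_image_eq_lintegral_abs_deriv_mul measurableSet_Ioi
    (f' := fun r => r / √(r ^ 2 - a ^ 2))]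
  · refine setLIntegral_congr_fun measurableSet_Ioi fun r hr => ?_
    rw [abs_of_nonneg (div_nonneg (ha.trans hr.le) (Real.sqrt_nonneg _))]
  · intro r hr
    have h1 : HasDerivAt (fun r : ℝ => r ^ 2 - a ^ 2) (2 * r) r := by
      simpa using (hasDerivAt_pow 2 r).sub_const (a ^ 2)
    refine (h1.sqrt (hpos r hr).ne').hasDerivWithinAt.congr_deriv ?_
    field_simp
  · intro r hr s hs hrs
    simp only at hrs
    have h1 := (Real.sqrt_inj (hpos r hr).le (hpos s hs).le).1 hrs
    have hr' : 0 ≤ r := ha.trans (le_of_lt hr)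
    have hs' : 0 ≤ s := ha.trans (le_of_lt hs)
    exact (pow_left_inj₀ hr' hs' two_ne_zero).1 (by linarith)

theorem lintegral_comp_smul_of_pos {n : ℕ} {r : ℝ} (hr : 0 < r) {g : Euc n → ℝ≥0∞}
    (hg : Measurable g) :
    ∫⁻ y, g y = ENNReal.ofReal (r ^ n) * ∫⁻ x, g (r • x) := by
  have h := lintegral_map (μ := volume) hg (measurable_const_smul r : Measurable fun x : Euc n => r • x)
  rw [Measure.map_addHaar_smul _ hr.ne', lintegral_smul_measure, finrank_euclideanSpace_fin,
    abs_of_pos (by positivity)] at h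
  rw [← h, smul_eq_mul, ← mul_assoc, ← ENNReal.ofReal_mul (by positivity),
    mul_inv_cancel₀ (by positivity), ENNReal.ofReal_one, one_mul]

/-- The first `n` coordinates. -/
def firstCoords {d n m : ℕ} (h : d + 1 = n + m) (x : Euc (d + 1)) : Euc n :=
  WithLp.toLp 2 fun i => x (Fin.cast h.symm (Fin.castAdd m i))

theorem measurable_firstCoords {d n m : ℕ} (h : d + 1 = n + m) : Measurable (firstCoords h) := by
  unfold firstCoords
  fun_prop

theorem firstCoords_smul {d n m : ℕ} (h : d + 1 = n + m) (r : ℝ) (x : Euc (d + 1)) :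
    firstCoords h (r • x) = r • firstCoords h x := by
  ext i
  simp [firstCoords]

/-- The function of the first coordinates is extended from the sphere to the ball with homogeneity
0, so that the flat product structure of the ball can be used. The factor is ∫₀¹ r^d dr. -/
theorem lintegral_firstCoords_ball {d n m : ℕ} (h : d + 1 = n + m) {f : Euc n → ℝ≥0∞}
    (hf : Measurable f) :
    ∫⁻ x : Euc (d + 1), (if ‖x‖ < 1 then f (‖x‖⁻¹ • firstCoords h x) else 0) =
      (∫⁻ ζ : Sph d, f (firstCoords h ζ) ∂(volume : Measure (Euc (d + 1))).toSphere) *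
        ENNReal.ofReal (1 / (d + 1)) := by
  have hm := measurable_firstCoords h
  have hF : Measurable fun x : Euc (d + 1) =>
      if ‖x‖ < 1 then f (‖x‖⁻¹ • firstCoords h x) else 0 :=
    Measurable.ite (measurableSet_lt (by fun_prop) (by fun_prop)) (by fun_prop) (by fun_prop)
  have hm' : Measurable fun ζ : Sph d => firstCoords h ζ := hm.comp measurable_subtype_coe
  rw [lintegral_eq_lintegral_sphere_prod volume hF, ← lintegral_mul_const _ (by fun_prop)]
  refine lintegral_congr fun ζ => ?_
  have h1 : ∀ r : Set.Ioi (0 : ℝ), (if ‖(r : ℝ) • (ζ : Euc (d + 1))‖ < 1 then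
      f (‖(r : ℝ) • (ζ : Euc (d + 1))‖⁻¹ • firstCoords h ((r : ℝ) • (ζ : Euc (d + 1)))) else 0) =
      (Set.Iio (⟨1, Set.mem_Ioi.2 zero_lt_one⟩ : Set.Ioi (0 : ℝ))).indicator
        (fun _ => f (firstCoords h ζ)) r := by
    intro r
    have hr := r.2.out
    rw [firstCoords_smul, norm_smul, norm_eq_of_mem_sphere, mul_one, Real.norm_of_nonneg hr.le,
      smul_smul, inv_mul_cancel₀ hr.ne', one_smul, Set.indicator_apply]
    rfl
  simp_rw [h1]
  rw [lintegral_indicator measurableSet_Iio, lintegral_const, Measure.restrict_apply_univ,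
    Measure.volumeIoiPow_apply_Iio]
  simp

/-- The same ball integral, computed in ℝⁿ × ℝᵐ: polar coordinates in z, change of variable from |z|
to the total radius r, exchange of the integrals, and scaling y = r x. The two expressions of this
integral give the law of the first coordinates. -/
theorem lintegral_prod_ball {n m : ℕ} (hm : 1 ≤ m) {f : Euc n → ℝ≥0∞} (hf : Measurable f) :
    ∫⁻ y : Euc n, ∫⁻ z : Euc m, (if ‖y‖ ^ 2 + ‖z‖ ^ 2 < 1 then
        f ((√(‖y‖ ^ 2 + ‖z‖ ^ 2))⁻¹ • y) else 0) =
      (volume : Measure (Euc m)).toSphere Set.univ *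
      (∫⁻ r in Set.Ioo (0 : ℝ) 1, ENNReal.ofReal (r ^ n * r ^ (m - 1))) *
      ∫⁻ x in Metric.ball (0 : Euc n) 1,
        ENNReal.ofReal ((1 - ‖x‖ ^ 2) ^ (((m : ℝ) - 2) / 2)) * f x := by
  have : Nonempty (Fin m) := ⟨⟨0, hm⟩⟩
  obtain ⟨G, hG⟩ : ∃ G : Euc n → ℝ → ℝ≥0∞, ∀ y r, G y r = if ‖y‖ < r then
      ENNReal.ofReal (r ^ (m - 1) * (1 - ‖r⁻¹ • y‖ ^ 2) ^ (((m : ℝ) - 2) / 2)) * f (r⁻¹ • y)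
      else 0 := ⟨_, fun _ _ => rfl⟩
  have step1 : ∀ y : Euc n, ∫⁻ z : Euc m, (if ‖y‖ ^ 2 + ‖z‖ ^ 2 < 1 then
        f ((√(‖y‖ ^ 2 + ‖z‖ ^ 2))⁻¹ • y) else 0) =
      (∫⁻ r in Set.Ioo (0 : ℝ) 1, G y r) * (volume : Measure (Euc m)).toSphere Set.univ := by
    intro y
    have hg : Measurable fun s : ℝ => if ‖y‖ ^ 2 + s ^ 2 < 1 then
        f ((√(‖y‖ ^ 2 + s ^ 2))⁻¹ • y) else 0 :=
      Measurable.ite (measurableSet_lt (by fun_prop) (by fun_prop)) (by fun_prop) (by fun_prop)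
    rw [lintegral_norm_eq_lintegral_Ioi volume hg, finrank_euclideanSpace_fin,
      lintegral_Ioi_comp_sqrt (norm_nonneg y)]
    congr 1
    rw [← lintegral_indicator measurableSet_Ioi, ← lintegral_indicator measurableSet_Ioo]
    refine lintegral_congr fun r => ?_
    rw [Set.indicator_apply, Set.indicator_apply, hG]
    by_cases hr : ‖y‖ < r
    swap
    · simp [hr]
    have hr0 : 0 < r := (norm_nonneg y).trans_lt hr
    have hpos : 0 < r ^ 2 - ‖y‖ ^ 2 := by nlinarith [norm_nonneg y]
    rw [if_pos (Set.mem_Ioi.2 hr), if_pos hr, Real.sq_sqrt hpos.le, add_sub_cancel,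
      Real.sqrt_sq hr0.le]
    by_cases hr1 : r < 1
    swap
    · rw [if_neg (by nlinarith), if_neg (fun h => hr1 h.2), mul_zero, mul_zero]
    rw [if_pos (by nlinarith), if_pos ⟨hr0, hr1⟩, ← mul_assoc,
      ← ENNReal.ofReal_mul (by positivity)]
    congr 2
    have e1 : 1 - ‖r⁻¹ • y‖ ^ 2 = (r ^ 2 - ‖y‖ ^ 2) / r ^ 2 := by
      rw [norm_smul, Real.norm_of_nonneg (by positivity)]
      field_simp
    -- The Jacobian r/s lowers the exponent m - 1 of s by one. Real exponents are needed because m -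
    -- 2 is negative when m = 1.
    have e2 : √(r ^ 2 - ‖y‖ ^ 2) ^ (m - 1) = √(r ^ 2 - ‖y‖ ^ 2) ^ ((m : ℝ) - 2) *
        √(r ^ 2 - ‖y‖ ^ 2) := by
      rw [← Real.rpow_natCast, ← Real.rpow_add_one (Real.sqrt_pos.2 hpos).ne']
      congr 1
      push_cast [Nat.cast_sub hm]
      ring
    have e3 : r ^ (m - 1) = r ^ ((m : ℝ) - 2) * r := by
      rw [← Real.rpow_natCast, ← Real.rpow_add_one hr0.ne']
      congr 1
      push_cast [Nat.cast_sub hm]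
      ring
    rw [e1, e2, e3]
    generalize r ^ 2 - ‖y‖ ^ 2 = X at hpos ⊢
    rw [Real.div_rpow hpos.le (by positivity), Real.sqrt_eq_rpow,
      ← Real.rpow_mul hpos.le, ← Real.rpow_natCast r 2, ← Real.rpow_mul hr0.le]
    have e4 : ((2 : ℕ) : ℝ) * (((m : ℝ) - 2) / 2) = (m : ℝ) - 2 := by push_cast; ring
    have e5 : 1 / 2 * ((m : ℝ) - 2) = ((m : ℝ) - 2) / 2 := by ring
    have := (Real.rpow_pos_of_pos hr0 ((m : ℝ) - 2)).ne'
    have := (Real.rpow_pos_of_pos hpos (1 / 2 : ℝ)).ne'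
    rw [e4, e5]
    generalize X ^ (1 / 2 : ℝ) = Y at this ⊢
    field_simp
  simp_rw [step1]
  have hmeas : Measurable (Function.uncurry G) := by
    simp only [Function.uncurry_def, hG]
    exact Measurable.ite (measurableSet_lt (by fun_prop) (by fun_prop)) (by fun_prop) (by fun_prop)
  have hmeas' : Measurable fun y => ∫⁻ r in Set.Ioo (0 : ℝ) 1, G y r :=
    hmeas.lintegral_prod_right'
  rw [lintegral_mul_const _ hmeas',
    lintegral_lintegral_swap hmeas.aemeasurable, mul_comm, mul_assoc]
  congr 1
  rw [← lintegral_mul_const _ (by fun_prop)]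
  refine setLIntegral_congr_fun measurableSet_Ioo fun r hr => ?_
  have hr0 := hr.1
  rw [lintegral_comp_smul_of_pos hr0 (hmeas.of_uncurry_right (y := r)),
    ENNReal.ofReal_mul (by positivity), mul_assoc]
  congr 1
  rw [← lintegral_indicator Metric.isOpen_ball.measurableSet, ← lintegral_const_mul']
  · refine lintegral_congr fun x => ?_
    classical
    rw [Set.indicator_apply, hG, norm_smul, Real.norm_of_nonneg hr0.le, smul_smul,
      inv_mul_cancel₀ hr0.ne', one_smul]
    by_cases hx : ‖x‖ < 1
    · rw [if_pos (by nlinarith), if_pos (by simpa using hx), ENNReal.ofReal_mul (by positivity),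
        mul_assoc]
    · rw [if_neg (by nlinarith), if_neg (by simpa using hx), mul_zero]
  · exact ENNReal.ofReal_ne_top

/-- The law of the first `n` coordinates of a uniform point of the sphere `S^d`. -/
theorem exists_lintegral_unif_firstCoords {d n m : ℕ} (h : d + 1 = n + m) (hm : 1 ≤ m) :
    ∃ κ : ℝ≥0∞, κ ≠ ⊤ ∧ ∀ f : Euc n → ℝ≥0∞, Measurable f →
      ∫⁻ ζ : Sph d, f (firstCoords h ζ) ∂(unif d) = κ * ∫⁻ x in Metric.ball (0 : Euc n) 1,
        ENNReal.ofReal ((1 - ‖x‖ ^ 2) ^ (((m : ℝ) - 2) / 2)) * f x := by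
  obtain ⟨Φ, hΦ, hΦ1, hΦn⟩ := exists_measurePreserving_split h
  set σ := (volume : Measure (Euc (d + 1))).toSphere Set.univ with hσ
  set S := (volume : Measure (Euc m)).toSphere Set.univ
  set D := ∫⁻ r in Set.Ioo (0 : ℝ) 1, ENNReal.ofReal (r ^ n * r ^ (m - 1))
  set c := ENNReal.ofReal (1 / (d + 1))
  have hc0 : c ≠ 0 := by simp only [c, ne_eq, ENNReal.ofReal_eq_zero, not_le]; positivity
  have hc1 : c ≠ ⊤ := ENNReal.ofReal_ne_top
  have hσ0 : σ ≠ 0 := by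
    rw [hσ, Ne, Measure.measure_univ_eq_zero]
    exact Measure.toSphere_ne_zero _
  have hD : D ≠ ⊤ := by
    refine ((setLIntegral_mono (g := fun _ => 1) measurable_const fun r hr => ?_).trans_lt ?_).ne
    · rw [← ENNReal.ofReal_one]
      refine ENNReal.ofReal_le_ofReal ?_
      exact mul_le_one₀ (pow_le_one₀ hr.1.le hr.2.le) (pow_nonneg hr.1.le _)
        (pow_le_one₀ hr.1.le hr.2.le)
    · simp
  refine ⟨σ⁻¹ * (S * D * c⁻¹), ?_, fun f hf => ?_⟩
  · exact ENNReal.mul_ne_top (ENNReal.inv_ne_top.2 hσ0) (ENNReal.mul_ne_top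
      (ENNReal.mul_ne_top (measure_ne_top _ _) hD) (ENNReal.inv_ne_top.2 hc0))
  have key : (∫⁻ ζ : Sph d, f (firstCoords h ζ) ∂(volume : Measure (Euc (d + 1))).toSphere) * c =
      S * D * ∫⁻ x in Metric.ball (0 : Euc n) 1,
        ENNReal.ofReal ((1 - ‖x‖ ^ 2) ^ (((m : ℝ) - 2) / 2)) * f x := by
    rw [← lintegral_firstCoords_ball h hf, ← lintegral_prod_ball hm hf]
    have hmeas : Measurable fun p : Euc n × Euc m => if ‖p.1‖ ^ 2 + ‖p.2‖ ^ 2 < 1 then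
        f ((√(‖p.1‖ ^ 2 + ‖p.2‖ ^ 2))⁻¹ • p.1) else 0 :=
      Measurable.ite (measurableSet_lt (by fun_prop) (by fun_prop)) (by fun_prop) (by fun_prop)
    rw [← lintegral_prod _ hmeas.aemeasurable]
    have h2 := hΦ.lintegral_comp hmeas
    rw [Measure.volume_eq_prod] at h2
    rw [← h2]
    refine lintegral_congr fun x => ?_
    have h3 : firstCoords h x = (Φ x).1 := by
      ext i
      rw [hΦ1]
      rfl
    rw [← hΦn, Real.sqrt_sq (norm_nonneg _), h3]
    have h4 : ‖x‖ ^ 2 < 1 ↔ ‖x‖ < 1 := by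
      rw [sq_lt_one_iff₀ (norm_nonneg _)]
    simp only [h4]
  rw [unif, lintegral_smul_measure, smul_eq_mul, mul_assoc]
  congr 1
  rw [mul_assoc, mul_comm c⁻¹, ← mul_assoc, ← key, mul_assoc, ENNReal.mul_inv_cancel hc0 hc1,
    mul_one]

/-! ### Poincaré's limit: from the sphere to the Gaussian measure -/

/-- The linear map `x ↦ √d (x₁, …, xₙ)` whose restriction to `S^d` is used in `liftToSphere`. -/
def scaledCoords (n d : ℕ) : Euc (d + 1) →L[ℝ] Euc n :=
  LinearMap.toContinuousLinearMap
    { toFun := fun x => WithLp.toLp 2 fun i : Fin n =>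
        if h : (i : ℕ) < d + 1 then Real.sqrt d * x ⟨i, h⟩ else 0
      map_add' := fun x y => by
        ext i
        by_cases h : (i : ℕ) ≤ d <;> simp [h, mul_add]
      map_smul' := fun r x => by
        ext i
        by_cases h : (i : ℕ) ≤ d <;> simp [h, mul_left_comm] }

theorem liftToSphere_eq {n : ℕ} (v : Euc n → ℝ) (d : ℕ) :
    liftToSphere v d = fun ζ : Sph d => v (scaledCoords n d ζ) := rfl

theorem scaledCoords_apply {n d : ℕ} (hd : n ≤ d) (x : Euc (d + 1)) (i : Fin n) :
    scaledCoords n d x i = √d * x ⟨i, by omega⟩ := by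
  have h : (i : ℕ) ≤ d := by omega
  simp [scaledCoords, h]

theorem scaledCoords_eq_smul_firstCoords {n m d : ℕ} (h : d + 1 = n + m) (hm : 1 ≤ m)
    (x : Euc (d + 1)) : scaledCoords n d x = √d • firstCoords h x := by
  ext i
  rw [scaledCoords_apply (by omega)]
  rfl

theorem measurable_scaledCoords_sphere (n d : ℕ) :
    Measurable fun ζ : Sph d => scaledCoords n d ζ :=
  (scaledCoords n d).continuous.measurable.comp measurable_subtype_coe

/-- The unnormalized density of the law of `√d (ζ₁, …, ζₙ)` for `ζ` uniform on `S^d`. -/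
def sphereWeight (n d : ℕ) (y : Euc n) : ℝ :=
  if ‖y‖ ^ 2 < d then (1 - ‖y‖ ^ 2 / d) ^ (((d : ℝ) - 1 - n) / 2) else 0

/-- The density of the law of `√d (ζ₁, …, ζₙ)` for `ζ` uniform on `S^d`. -/
def sphereDensity (n d : ℕ) (y : Euc n) : ℝ :=
  (∫ x, sphereWeight n d x)⁻¹ * sphereWeight n d y

/-- The density of the Gaussian measure. -/
def gaussDensity (n : ℕ) (y : Euc n) : ℝ :=
  (2 * Real.pi) ^ (-(n : ℝ) / 2) * Real.exp (-‖y‖ ^ 2 / 2)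

theorem measurable_sphereWeight (n d : ℕ) : Measurable (sphereWeight n d) :=
  Measurable.ite (measurableSet_lt (by fun_prop) (by fun_prop)) (by fun_prop) (by fun_prop)

theorem measurable_sphereDensity (n d : ℕ) : Measurable (sphereDensity n d) :=
  (measurable_sphereWeight n d).const_mul _

theorem sphereWeight_nonneg (n d : ℕ) (y : Euc n) : 0 ≤ sphereWeight n d y := by
  unfold sphereWeight
  split_ifs with h
  · have hd : (0 : ℝ) < d := (sq_nonneg _).trans_lt h
    exact Real.rpow_nonneg (sub_nonneg.2 ((div_le_one hd).2 h.le)) _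
  · exact le_rfl

theorem sphereDensity_nonneg (n d : ℕ) (y : Euc n) : 0 ≤ sphereDensity n d y :=
  mul_nonneg (inv_nonneg.2 (integral_nonneg (sphereWeight_nonneg n d))) (sphereWeight_nonneg n d y)

/-- Since 1 - s ≤ exp(-s), the weight is at most exp(-(|y|²/d) (d-1-n)/2). The condition 2(n+1) ≤ d
says exactly that (d-1-n)/2 ≥ d/4, whence the constant 1/4, independent of d. -/
theorem sphereWeight_le_exp {n d : ℕ} (hd : 2 * (n + 1) ≤ d) (y : Euc n) :
    sphereWeight n d y ≤ Real.exp (-(1 / 4) * ‖y‖ ^ 2) := by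
  unfold sphereWeight
  split_ifs with h
  swap
  · positivity
  have hd' : (2 : ℝ) * (n + 1) ≤ d := by exact_mod_cast hd
  have hd0 : (0 : ℝ) < d := (sq_nonneg _).trans_lt h
  have hx : 0 ≤ 1 - ‖y‖ ^ 2 / d := sub_nonneg.2 ((div_le_one hd0).2 h.le)
  have ha : (d : ℝ) / 4 ≤ ((d : ℝ) - 1 - n) / 2 := by linarith
  calc (1 - ‖y‖ ^ 2 / d) ^ (((d : ℝ) - 1 - n) / 2)
      ≤ Real.exp (-(‖y‖ ^ 2 / d)) ^ (((d : ℝ) - 1 - n) / 2) :=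
        Real.rpow_le_rpow hx (Real.one_sub_le_exp_neg _) (by linarith [hd0.le])
    _ = Real.exp (-(‖y‖ ^ 2 / d) * (((d : ℝ) - 1 - n) / 2)) := by rw [← Real.exp_mul]
    _ ≤ Real.exp (-(‖y‖ ^ 2 / d) * (d / 4)) := by
        refine Real.exp_le_exp.2 (mul_le_mul_of_nonpos_left ha ?_)
        exact neg_nonpos.2 (by positivity)
    _ = Real.exp (-(1 / 4) * ‖y‖ ^ 2) := by
        congr 1
        field_simp

theorem integrable_exp_neg_mul_sq_norm (n : ℕ) {b : ℝ} (hb : 0 < b) :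
    Integrable fun y : Euc n => Real.exp (-b * ‖y‖ ^ 2) := by
  refine Integrable.of_integral_ne_zero ?_
  rw [GaussianFourier.integral_rexp_neg_mul_sq_norm hb]
  positivity

theorem integrable_sphereWeight {n d : ℕ} (hd : 2 * (n + 1) ≤ d) :
    Integrable (sphereWeight n d) :=
  (integrable_exp_neg_mul_sq_norm n (by norm_num : (0 : ℝ) < 1 / 4)).mono'
    (measurable_sphereWeight n d).aestronglyMeasurable
    (Eventually.of_forall fun y => by
      rw [Real.norm_of_nonneg (sphereWeight_nonneg n d y)]
      exact sphereWeight_le_exp hd y)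

/-- For d > |y|² the weight is ((1 - |y|²/d)^d)^((1 - (1+n)/d)/2); the base tends to exp(-|y|²) and
the exponent to 1/2. -/
theorem tendsto_sphereWeight {n : ℕ} (y : Euc n) :
    Tendsto (fun d => sphereWeight n d y) atTop (𝓝 (Real.exp (-(1 / 2) * ‖y‖ ^ 2))) := by
  have hcast : Tendsto (fun d : ℕ => (d : ℝ)) atTop atTop := tendsto_natCast_atTop_atTop
  have h1 : Tendsto (fun d : ℕ => (1 + (-‖y‖ ^ 2) / (d : ℝ)) ^ (d : ℝ)) atTop
      (𝓝 (Real.exp (-‖y‖ ^ 2))) := (Real.tendsto_one_add_div_rpow_exp _).comp hcast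
  have h2 : Tendsto (fun d : ℕ => (1 - (1 + n : ℝ) / d) / 2) atTop (𝓝 (1 / 2)) := by
    have : Tendsto (fun d : ℕ => (1 + n : ℝ) / d) atTop (𝓝 0) := hcast.const_div_atTop _
    simpa using (this.const_sub 1).div_const 2
  have h3 := h1.rpow h2 (Or.inl (Real.exp_pos _).ne')
  have h4 : Real.exp (-‖y‖ ^ 2) ^ (1 / 2 : ℝ) = Real.exp (-(1 / 2) * ‖y‖ ^ 2) := by
    rw [← Real.exp_mul]
    ring_nf
  rw [h4] at h3
  refine h3.congr' ?_
  filter_upwards [hcast.eventually_gt_atTop (‖y‖ ^ 2)] with d hd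
  have hd0 : (0 : ℝ) < d := (sq_nonneg _).trans_lt hd
  have hx : 0 ≤ 1 - ‖y‖ ^ 2 / d := sub_nonneg.2 ((div_le_one hd0).2 hd.le)
  rw [sphereWeight, if_pos hd, neg_div, ← sub_eq_add_neg, ← Real.rpow_mul hx]
  congr 1
  field_simp
  ring

theorem tendsto_integral_sphereWeight (n : ℕ) :
    Tendsto (fun d => ∫ y, sphereWeight n d y) atTop (𝓝 ((2 * Real.pi) ^ ((n : ℝ) / 2))) := by
  have h := tendsto_integral_filter_of_dominated_convergence (μ := (volume : Measure (Euc n)))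
    (F := fun d => sphereWeight n d) (f := fun y => Real.exp (-(1 / 2) * ‖y‖ ^ 2)) (l := atTop)
    (fun y => Real.exp (-(1 / 4) * ‖y‖ ^ 2))
    (Eventually.of_forall fun d => (measurable_sphereWeight n d).aestronglyMeasurable)
    ?_ (integrable_exp_neg_mul_sq_norm n (by norm_num))
    (Eventually.of_forall tendsto_sphereWeight)
  · rw [GaussianFourier.integral_rexp_neg_mul_sq_norm (by norm_num), finrank_euclideanSpace_fin]
      at h
    convert h using 3
    ring
  · filter_upwards [eventually_ge_atTop (2 * (n + 1))] with d hd
    refine Eventually.of_forall fun y => ?_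
    rw [Real.norm_of_nonneg (sphereWeight_nonneg n d y)]
    exact sphereWeight_le_exp hd y

theorem tendsto_sphereDensity {n : ℕ} (y : Euc n) :
    Tendsto (fun d => sphereDensity n d y) atTop (𝓝 (gaussDensity n y)) := by
  have h := ((tendsto_integral_sphereWeight n).inv₀ (by positivity)).mul (tendsto_sphereWeight y)
  have h2 : gaussDensity n y =
      ((2 * Real.pi) ^ ((n : ℝ) / 2))⁻¹ * Real.exp (-(1 / 2) * ‖y‖ ^ 2) := by
    unfold gaussDensity
    rw [neg_div, Real.rpow_neg (by positivity)]
    ring_nf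
  rw [h2]
  exact h

theorem exists_sphereDensity_le (n : ℕ) :
    ∃ C : ℝ, 0 < C ∧ ∀ᶠ d in atTop, ∀ y, sphereDensity n d y ≤ C := by
  have hlim := (tendsto_integral_sphereWeight n).inv₀ (by positivity)
  set L := ((2 * Real.pi) ^ ((n : ℝ) / 2))⁻¹ with hL
  have hL0 : 0 < L := by positivity
  refine ⟨L + 1, by positivity, ?_⟩
  filter_upwards [hlim.eventually_lt_const (lt_add_one L), eventually_ge_atTop (2 * (n + 1))]
    with d hd hd2 y
  calc sphereDensity n d y ≤ (L + 1) * 1 :=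
        mul_le_mul hd.le ((sphereWeight_le_exp hd2 y).trans (Real.exp_le_one_iff.2 (by
          nlinarith [sq_nonneg ‖y‖]))) (sphereWeight_nonneg n d y) (by positivity)
    _ = L + 1 := mul_one _

/-- The law of `√d (ζ₁, …, ζₙ)` for `ζ` uniform on `S^d`. -/
theorem map_scaledCoords_unif {n d : ℕ} (hd : 2 * (n + 1) ≤ d) :
    (unif d).map (fun ζ : Sph d => scaledCoords n d ζ) =
      volume.withDensity fun y => ENNReal.ofReal (sphereDensity n d y) := by
  obtain ⟨m, hm⟩ : ∃ m, d + 1 = n + m := ⟨d + 1 - n, by omega⟩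
  have hm1 : 1 ≤ m := by omega
  have hd0 : (0 : ℝ) < d := by
    have : 0 < d := by omega
    exact_mod_cast this
  have hs0 : 0 < √(d : ℝ) := Real.sqrt_pos.2 hd0
  have hT := measurable_scaledCoords_sphere n d
  have hk : ((m : ℝ) - 2) / 2 = ((d : ℝ) - 1 - n) / 2 := by
    have : (d : ℝ) + 1 = n + m := by exact_mod_cast hm
    linarith
  obtain ⟨κ, hκ, hf⟩ := exists_lintegral_unif_firstCoords hm hm1
  set κ' := κ * (ENNReal.ofReal (√(d : ℝ) ^ n))⁻¹
  have key : ∀ f : Euc n → ℝ≥0∞, Measurable f → ∫⁻ ζ : Sph d, f (scaledCoords n d ζ) ∂(unif d) =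
      κ' * ∫⁻ y, ENNReal.ofReal (sphereWeight n d y) * f y := by
    intro f hfm
    simp_rw [scaledCoords_eq_smul_firstCoords hm hm1]
    have hw := (measurable_sphereWeight n d).ennreal_ofReal
    rw [hf (fun x => f (√d • x)) (by fun_prop), lintegral_comp_smul_of_pos hs0 (by fun_prop),
      ← mul_assoc κ', mul_assoc κ, ENNReal.inv_mul_cancel
        (ENNReal.ofReal_pos.2 (pow_pos hs0 n)).ne' ENNReal.ofReal_ne_top, mul_one,
      ← lintegral_indicator Metric.isOpen_ball.measurableSet]
    congr 1
    refine lintegral_congr fun x => ?_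
    classical
    have h1 : ‖√(d : ℝ) • x‖ ^ 2 = d * ‖x‖ ^ 2 := by
      rw [norm_smul, mul_pow, Real.norm_of_nonneg hs0.le, Real.sq_sqrt hd0.le]
    rw [Set.indicator_apply, sphereWeight, h1, mul_div_cancel_left₀ _ hd0.ne', hk]
    have h2 : (d : ℝ) * ‖x‖ ^ 2 < d ↔ x ∈ Metric.ball (0 : Euc n) 1 := by
      rw [mem_ball_zero_iff, mul_lt_iff_lt_one_right hd0, sq_lt_one_iff₀ (norm_nonneg _)]
    simp only [h2]
    split_ifs <;> simp
  have hint := integrable_sphereWeight hd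
  have hI : ∫⁻ y, ENNReal.ofReal (sphereWeight n d y) =
      ENNReal.ofReal (∫ y, sphereWeight n d y) :=
    (ofReal_integral_eq_lintegral_ofReal hint
      (Eventually.of_forall (sphereWeight_nonneg n d))).symm
  -- Testing with the constant 1 identifies the normalization: the measure has mass 1, so the
  -- integral of the weight is nonzero and `κ'` is its inverse. No surface area has to be computed.
  have hone := key (fun _ => 1) measurable_const
  simp only [lintegral_const, measure_univ, mul_one, hI] at hone
  have hpos : 0 < ∫ y, sphereWeight n d y := by
    refine lt_of_le_of_ne (integral_nonneg (sphereWeight_nonneg n d)) fun h0 => ?_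
    simp [← h0] at hone
  have hκ' : κ' = ENNReal.ofReal (∫ y, sphereWeight n d y)⁻¹ := by
    rw [ENNReal.ofReal_inv_of_pos hpos]
    exact ENNReal.eq_inv_of_mul_eq_one_left hone.symm
  refine Measure.ext_of_lintegral _ fun f hfm => ?_
  rw [lintegral_map hfm hT, key f hfm, lintegral_withDensity_eq_lintegral_mul _
    (measurable_sphereDensity n d).ennreal_ofReal hfm, hκ',
    ← lintegral_const_mul' _ _ ENNReal.ofReal_ne_top]
  refine lintegral_congr fun y => ?_
  rw [← mul_assoc, ← ENNReal.ofReal_mul (by positivity)]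
  rfl

theorem gauss_eq (n : ℕ) :
    gauss n = volume.withDensity fun y => ENNReal.ofReal (gaussDensity n y) := rfl

theorem measurable_gaussDensity (n : ℕ) : Measurable (gaussDensity n) := by
  unfold gaussDensity
  fun_prop

theorem gaussDensity_pos (n : ℕ) (y : Euc n) : 0 < gaussDensity n y := by
  unfold gaussDensity
  positivity

theorem absolutelyContinuous_gauss (n : ℕ) : volume ≪ gauss n := by
  refine withDensity_absolutelyContinuous' (measurable_gaussDensity n).ennreal_ofReal.aemeasurable ?_
  exact Eventually.of_forall fun y => (ENNReal.ofReal_pos.2 (gaussDensity_pos n y)).ne'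

theorem gauss_le_smul (n : ℕ) :
    gauss n ≤ ENNReal.ofReal ((2 * Real.pi) ^ (-(n : ℝ) / 2)) • volume := by
  rw [gauss_eq, ← withDensity_const]
  refine withDensity_mono (Eventually.of_forall fun y => ENNReal.ofReal_le_ofReal ?_)
  refine mul_le_of_le_one_right (by positivity) (Real.exp_le_one_iff.2 ?_)
  nlinarith [sq_nonneg ‖y‖]

theorem memLp_gauss {n : ℕ} {E : Type*} [NormedAddCommGroup E] {f : Euc n → E} {p : ℝ≥0∞}
    (hf : MemLp f p volume) : MemLp f p (gauss n) :=
  hf.of_measure_le_smul ENNReal.ofReal_ne_top (gauss_le_smul n)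

theorem quasiMeasurePreserving_scaledCoords {n d : ℕ} (hd : 2 * (n + 1) ≤ d) :
    Measure.QuasiMeasurePreserving (fun ζ : Sph d => scaledCoords n d ζ) (unif d) volume :=
  ⟨measurable_scaledCoords_sphere n d, by
    rw [map_scaledCoords_unif hd]
    exact withDensity_absolutelyContinuous _ _⟩

/-- Because of this domination, composition with `scaledCoords` maps Lebesgue L^p functions to L^p
functions on the sphere, for all large d. -/
theorem exists_map_scaledCoords_le (n : ℕ) :
    ∃ C : ℝ≥0∞, C ≠ ⊤ ∧ ∀ᶠ d in atTop,
      (unif d).map (fun ζ : Sph d => scaledCoords n d ζ) ≤ C • volume := by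
  obtain ⟨C, -, hC⟩ := exists_sphereDensity_le n
  refine ⟨ENNReal.ofReal C, ENNReal.ofReal_ne_top, ?_⟩
  filter_upwards [hC, eventually_ge_atTop (2 * (n + 1))] with d hd hd2
  rw [map_scaledCoords_unif hd2, ← withDensity_const]
  exact withDensity_mono (Eventually.of_forall fun y => ENNReal.ofReal_le_ofReal (hd y))

theorem integral_unif_comp_scaledCoords {n d : ℕ} (hd : 2 * (n + 1) ≤ d) {f : Euc n → ℝ}
    (hf : AEStronglyMeasurable f volume) :
    ∫ ζ : Sph d, f (scaledCoords n d ζ) ∂(unif d) = ∫ y, sphereDensity n d y * f y := by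
  have hq := quasiMeasurePreserving_scaledCoords hd
  rw [← integral_map (f := f) hq.measurable.aemeasurable (hf.mono_ac hq.absolutelyContinuous),
    map_scaledCoords_unif hd, integral_withDensity_eq_integral_toReal_smul
      (measurable_sphereDensity n d).ennreal_ofReal (by simp)]
  simp [ENNReal.toReal_ofReal (sphereDensity_nonneg n d _)]

theorem integral_gauss_eq {n : ℕ} (f : Euc n → ℝ) :
    ∫ y, f y ∂(gauss n) = ∫ y, gaussDensity n y * f y := by
  rw [gauss_eq, integral_withDensity_eq_integral_toReal_smul
      (measurable_gaussDensity n).ennreal_ofReal (by simp)]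
  simp [ENNReal.toReal_ofReal (gaussDensity_pos n _).le]

/-- The Poincaré limit, in the form of a dominated convergence theorem. -/
theorem tendsto_integral_unif {n : ℕ} {f : ℕ → Euc n → ℝ} {g F : Euc n → ℝ}
    (hfm : ∀ᶠ d in atTop, AEStronglyMeasurable (f d) volume) (hF : Integrable F volume)
    (hb : ∀ᶠ d in atTop, ∀ᵐ y, |f d y| ≤ F y)
    (hlim : ∀ᵐ y, Tendsto (fun d => f d y) atTop (𝓝 (g y))) :
    Tendsto (fun d => ∫ ζ : Sph d, f d (scaledCoords n d ζ) ∂(unif d)) atTop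
      (𝓝 (∫ y, g y ∂(gauss n))) := by
  obtain ⟨C, hC0, hC⟩ := exists_sphereDensity_le n
  rw [integral_gauss_eq]
  refine Tendsto.congr' (f₁ := fun d => ∫ y, sphereDensity n d y * f d y) ?_ ?_
  · filter_upwards [hfm, eventually_ge_atTop (2 * (n + 1))] with d hd hd2
    exact (integral_unif_comp_scaledCoords hd2 hd).symm
  · refine tendsto_integral_filter_of_dominated_convergence (fun y => C * F y) ?_ ?_
      (hF.const_mul C) ?_
    · filter_upwards [hfm] with d hd
      exact (measurable_sphereDensity n d).aestronglyMeasurable.mul hd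
    · filter_upwards [hC, hb] with d hd hd2
      filter_upwards [hd2] with y hy
      rw [norm_mul, Real.norm_of_nonneg (sphereDensity_nonneg n d y)]
      exact mul_le_mul (hd y) hy (norm_nonneg _) hC0.le
    · filter_upwards [hlim] with y hy
      exact (tendsto_sphereDensity y).mul hy

/-! ### Divergence theorem on the sphere and uniqueness of weak gradients -/

section Polar

variable {E : Type*} [NormedAddCommGroup E] [NormedSpace ℝ E] [FiniteDimensional ℝ E]
  [MeasurableSpace E] [BorelSpace E] [Nontrivial E] (μ : Measure E) [μ.IsAddHaarMeasure]

/-- The integral in polar coordinates of a function that splits as a product. -/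
theorem integral_eq_mul_of_polar {K : E → ℝ} {H : Metric.sphere (0 : E) 1 → ℝ} {h : ℝ → ℝ}
    (hK : ∀ (ζ : Metric.sphere (0 : E) 1) (r : ℝ), 0 < r → K (r • (ζ : E)) = H ζ * h r) :
    ∫ x, K x ∂μ = (∫ ζ, H ζ ∂μ.toSphere) *
      ∫ r : Set.Ioi (0 : ℝ), h r ∂(Measure.volumeIoiPow (Module.finrank ℝ E - 1)) := by
  have hL : ∫ x, K x ∂μ = ∫ x : ({0}ᶜ : Set E), K x ∂(μ.comap (↑)) := by
    rw [integral_subtype_comap (measurableSet_singleton _).compl K, Measure.restrict_congr_set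
      (ae_eq_univ.2 (by simp) : ({(0 : E)}ᶜ : Set E) =ᵐ[μ] Set.univ), Measure.restrict_univ]
  rw [hL, ← integral_prod_mul (fun ζ => H ζ) (fun r : Set.Ioi (0 : ℝ) => h r),
    ← μ.measurePreserving_homeomorphUnitSphereProd.integral_comp
      (Homeomorph.measurableEmbedding _)]
  · refine integral_congr_ae (Eventually.of_forall fun x => ?_)
    have hx : ‖(x : E)‖ ≠ 0 := norm_ne_zero_iff.2 x.2
    have := hK (homeomorphUnitSphereProd E x).1 _ (homeomorphUnitSphereProd E x).2.2
    simpa [smul_smul, hx] using this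

end Polar

section Normalize

variable {E : Type*} [NormedAddCommGroup E] [InnerProductSpace ℝ E]

/-- The derivative of the radial projection is the orthogonal projection onto the tangent space,
divided by |x|. This is what makes the flat divergence of a radially constant extension a multiple
of `sphereDiv`. -/
theorem hasFDerivAt_norm_inv_smul {x : E} (hx : x ≠ 0) :
    ∃ A : E →L[ℝ] E, HasFDerivAt (fun y : E => ‖y‖⁻¹ • y) A x ∧
      ∀ w, A w = ‖x‖⁻¹ • (w - inner ℝ (‖x‖⁻¹ • x) w • (‖x‖⁻¹ • x)) := by
  have hx0 : ‖x‖ ≠ 0 := norm_ne_zero_iff.2 hx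
  have h1 : HasFDerivAt (fun y : E => √(‖y‖ ^ 2)) _ x :=
    (hasStrictFDerivAt_norm_sq x).hasFDerivAt.sqrt (by positivity)
  simp only [Real.sqrt_sq (norm_nonneg _)] at h1
  have h2 : HasFDerivAt (fun y : E => ‖y‖⁻¹ • y) _ x :=
    ((hasDerivAt_inv hx0).comp_hasFDerivAt x h1).smul (hasFDerivAt_id x)
  refine ⟨_, h2, fun w => ?_⟩
  simp only [add_apply, smul_apply, ContinuousLinearMap.smulRight_apply,
    ContinuousLinearMap.id_apply, innerSL_apply_apply, inner_smul_left, Function.comp_apply,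
    smul_eq_mul, nsmul_eq_mul, RCLike.conj_to_real, Nat.cast_ofNat]
  match_scalars <;> field_simp

end Normalize

theorem integral_fderiv_apply_eq_zero {E : Type*} [NormedAddCommGroup E] [NormedSpace ℝ E]
    [FiniteDimensional ℝ E] [MeasurableSpace E] [BorelSpace E] (μ : Measure E)
    [μ.IsAddHaarMeasure] {f : E → ℝ} (hf : ContDiff ℝ 1 f) (hs : HasCompactSupport f) (w : E) :
    ∫ x, fderiv ℝ f x w ∂μ = 0 := by
  have h := integral_mul_fderiv_eq_neg_fderiv_mul_of_integrable (μ := μ) (f := fun _ : E => (1 : ℝ))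
    (g := f) (v := w) (by simp) ?_ ?_ (fun _ _ => by fun_prop)
    (fun x _ => hf.differentiable one_ne_zero x)
  · simpa using h
  · simp only [one_mul]
    exact ((hf.continuous_fderiv one_ne_zero).clm_apply continuous_const).integrable_of_hasCompactSupport
      (hs.fderiv_apply (𝕜 := ℝ) w)
  · simpa using hf.continuous.integrable_of_hasCompactSupport hs

/-- The divergence theorem on the sphere. -/
theorem integral_sphereDiv {d : ℕ} {X : Euc (d + 1) → Euc (d + 1)} (hX : ContDiff ℝ ∞ X)
    (hXt : ∀ ζ : Sph d, inner ℝ (X ζ) (ζ : Euc (d + 1)) = 0) :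
    ∫ ζ, sphereDiv X ζ ∂(unif d) = 0 := by
  let β : ContDiffBump (1 : ℝ) := ⟨1 / 4, 1 / 2, by norm_num, by norm_num⟩
  set b : ℝ → ℝ := fun s => s * β s with hb
  have hbs : ContDiff ℝ 1 b := contDiff_id.mul β.contDiff
  have hb0 : ∀ s, (s ≤ 1 / 2 ∨ 3 / 2 ≤ s) → β s = 0 := by
    intro s hs
    refine β.zero_of_le_dist ?_
    rw [Real.dist_eq, le_abs]
    change 1 / 2 ≤ s - 1 ∨ 1 / 2 ≤ -(s - 1)
    rcases hs with h | h
    · right; linarith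
    · left; linarith
  -- `Z` extends X from the sphere, constant along rays, and is cut off to the shell 1/2 < |x|² <
  -- 3/2. Its divergence at rζ is b(r²) r⁻¹ times that of X at ζ; the factor s in b(s) turns this
  -- into r β(r²).
  set Z : Euc (d + 1) → Euc (d + 1) := fun x => b (‖x‖ ^ 2) • X (‖x‖⁻¹ • x) with hZ
  have hZ1 : ContDiff ℝ 1 Z := by
    rw [contDiff_iff_contDiffAt]
    intro x
    by_cases hx : x = 0
    · have : Z =ᶠ[𝓝 x] fun _ => 0 := by
        have hc : Continuous fun y : Euc (d + 1) => ‖y‖ ^ 2 := by fun_prop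
        have h0 : ‖x‖ ^ 2 < 1 / 2 := by simp [hx]
        filter_upwards [hc.continuousAt.eventually_lt_const h0] with y hy
        simp [hZ, hb, hb0 _ (Or.inl hy.le)]
      exact contDiffAt_const.congr_of_eventuallyEq this
    · have h1 : ContDiffAt ℝ 1 (fun y : Euc (d + 1) => ‖y‖⁻¹ • y) x :=
        ((contDiffAt_norm ℝ hx).inv (norm_ne_zero_iff.2 hx)).smul contDiffAt_id
      exact ((hbs.comp (contDiff_norm_sq ℝ)).contDiffAt).smul
        (((hX.of_le (by exact_mod_cast le_top)).contDiffAt).comp x h1)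
  have hZs : HasCompactSupport Z := by
    refine HasCompactSupport.intro (isCompact_closedBall 0 2) fun x hx => ?_
    have : 2 < ‖x‖ := by simpa using hx
    simp [hZ, hb, hb0 (‖x‖ ^ 2) (Or.inr (by nlinarith))]
  have hdiv0 : ∫ x, ∑ i, fderiv ℝ Z x (EuclideanSpace.single i 1) i = 0 := by
    have hcoord : ∀ (i : Fin (d + 1)) x w, fderiv ℝ Z x w i = fderiv ℝ (fun y => Z y i) x w := by
      intro i x w
      have h := ((EuclideanSpace.proj (𝕜 := ℝ) i).hasFDerivAt (x := Z x)).comp x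
        (hZ1.differentiable one_ne_zero x).hasFDerivAt
      have h' : HasFDerivAt (fun y => Z y i) _ x := h
      rw [h'.fderiv]
      rfl
    have hZi : ∀ i, ContDiff ℝ 1 fun y => Z y i := fun i =>
      (EuclideanSpace.proj (𝕜 := ℝ) i).contDiff.comp hZ1
    have hZsi : ∀ i, HasCompactSupport fun y => Z y i := fun i =>
      hZs.comp_left (g := fun z : Euc (d + 1) => z i) rfl
    simp_rw [hcoord]
    rw [integral_finsetSum]
    · exact Finset.sum_eq_zero fun i _ => integral_fderiv_apply_eq_zero volume (hZi i) (hZsi i) _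
    · exact fun i _ => (((hZi i).continuous_fderiv one_ne_zero).clm_apply
        continuous_const).integrable_of_hasCompactSupport ((hZsi i).fderiv_apply (𝕜 := ℝ) _)
  have hpt : ∀ (ζ : Sph d) (r : ℝ), 0 < r →
      ∑ i, fderiv ℝ Z (r • (ζ : Euc (d + 1))) (EuclideanSpace.single i 1) i =
        sphereDiv X ζ * (r * β (r ^ 2)) := by
    intro ζ r hr
    have hζ : ‖(ζ : Euc (d + 1))‖ = 1 := norm_eq_of_mem_sphere ζ
    set x := r • (ζ : Euc (d + 1)) with hxdef
    have hxn : ‖x‖ = r := by rw [hxdef, norm_smul, hζ, mul_one, Real.norm_of_nonneg hr.le]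
    have hx : x ≠ 0 := norm_ne_zero_iff.1 (by rw [hxn]; exact hr.ne')
    have hnx : ‖x‖⁻¹ • x = ζ := by rw [hxn, hxdef, smul_smul, inv_mul_cancel₀ hr.ne', one_smul]
    obtain ⟨A, hA, hAw⟩ := hasFDerivAt_norm_inv_smul hx
    rw [hnx, hxn] at hAw
    have hXd : HasFDerivAt X (fderiv ℝ X ζ) (‖x‖⁻¹ • x) := by
      rw [hnx]
      exact (hX.differentiable (by simp) _).hasFDerivAt
    have hbd : HasFDerivAt (fun y : Euc (d + 1) => b (‖y‖ ^ 2))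
        (deriv b (‖x‖ ^ 2) • (2 • innerSL ℝ x)) x :=
      HasDerivAt.comp_hasFDerivAt (h₂ := b) x (hbs.differentiable one_ne_zero _).hasDerivAt
        (hasStrictFDerivAt_norm_sq x).hasFDerivAt
    have hZd : HasFDerivAt Z _ x := hbd.smul
      (HasFDerivAt.comp (g := X) (f := fun y => ‖y‖⁻¹ • y) x hXd hA)
    rw [hnx] at hZd
    rw [hZd.fderiv]
    have hsum : ∀ i, ((b (‖x‖ ^ 2) • (fderiv ℝ X ζ).comp A +
        ((deriv b (‖x‖ ^ 2)) • (2 • innerSL ℝ x)).smulRight (X ζ))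
          (EuclideanSpace.single i 1)) i =
        b (r ^ 2) * r⁻¹ * (fderiv ℝ X ζ (EuclideanSpace.single i 1) i -
          (ζ : Euc (d + 1)) i * fderiv ℝ X ζ ζ i) +
        deriv b (r ^ 2) * 2 * r * (X ζ i * (ζ : Euc (d + 1)) i) := by
      intro i
      simp only [add_apply, smul_apply,
        ContinuousLinearMap.comp_apply, ContinuousLinearMap.smulRight_apply, hAw, map_smul, map_sub,
        hxn, innerSL_apply_apply, PiLp.add_apply, PiLp.smul_apply, PiLp.sub_apply, smul_eq_mul,
        EuclideanSpace.inner_single_right]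
      simp [hxdef]
      ring
    refine (Finset.sum_congr rfl fun i _ => hsum i).trans ?_
    rw [Finset.sum_add_distrib, ← Finset.mul_sum, ← Finset.mul_sum, Finset.sum_sub_distrib]
    -- Tangency of X removes the term coming from the radial derivative of the cut-off.
    have h1 : ∑ i, X ζ i * (ζ : Euc (d + 1)) i = 0 := by
      have := hXt ζ
      rw [PiLp.inner_apply] at this
      simpa [mul_comm] using this
    have h2 : ∑ i, (ζ : Euc (d + 1)) i * fderiv ℝ X ζ ζ i =
        inner ℝ (fderiv ℝ X ζ ζ) (ζ : Euc (d + 1)) := by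
      rw [PiLp.inner_apply]
      simp
    rw [h1, h2, sphereDiv, hb]
    field_simp
    ring
  have hpol := integral_eq_mul_of_polar (volume : Measure (Euc (d + 1)))
    (K := fun x => ∑ i, fderiv ℝ Z x (EuclideanSpace.single i 1) i)
    (h := fun r => r * β (r ^ 2)) hpt
  rw [hdiv0] at hpol
  -- By `hpol`, the spherical integral times a radial factor is 0. The same radial factor occurs in
  -- the positive integral of |x| β(|x|²), so it is not 0.
  have hpol2 := integral_eq_mul_of_polar (volume : Measure (Euc (d + 1)))
    (K := fun x => ‖x‖ * β (‖x‖ ^ 2)) (H := fun _ => 1) (h := fun r => r * β (r ^ 2))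
    (fun ζ r hr => by
      rw [norm_smul, norm_eq_of_mem_sphere, mul_one, Real.norm_of_nonneg hr.le, one_mul])
  have hpos : 0 < ∫ x : Euc (d + 1), ‖x‖ * β (‖x‖ ^ 2) := by
    refine Continuous.integral_pos_of_hasCompactSupport_nonneg_nonzero
      (x := EuclideanSpace.single 0 1) ?_ ?_ (fun x => mul_nonneg (norm_nonneg _) β.nonneg) ?_
    · have := β.continuous
      fun_prop
    · refine HasCompactSupport.intro (isCompact_closedBall 0 2) fun x hx => ?_
      have : 2 < ‖x‖ := by simpa using hx
      rw [hb0 (‖x‖ ^ 2) (Or.inr (by nlinarith)), mul_zero]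
    · have h1 : β 1 = 1 := β.one_of_mem_closedBall (by simp [β])
      simp [h1]
  rw [hpol2] at hpos
  have h0 := (mul_eq_zero.1 hpol.symm).resolve_right (right_ne_zero_of_mul hpos.ne')
  rw [unif, integral_smul_measure, h0, smul_zero]

theorem integrable_unif_of_continuous {d : ℕ} {E : Type*} [NormedAddCommGroup E] {f : Sph d → E}
    (hf : Continuous f) : Integrable f (unif d) :=
  hf.integrable_of_hasCompactSupport (HasCompactSupport.of_compactSpace f)

theorem continuous_sphereDiv {d : ℕ} {X : Euc (d + 1) → Euc (d + 1)} (hX : ContDiff ℝ ∞ X) :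
    Continuous (sphereDiv X : Sph d → ℝ) := by
  have h := hX.continuous_fderiv (by simp)
  have h' : Continuous fun ζ : Sph d => fderiv ℝ X ζ := h.comp continuous_subtype_val
  unfold sphereDiv
  have h1 : ∀ i, Continuous fun ζ : Sph d =>
      fderiv ℝ X (ζ : Euc (d + 1)) (EuclideanSpace.single i 1) i := fun i =>
    (EuclideanSpace.proj (𝕜 := ℝ) i).continuous.comp (h'.clm_apply continuous_const)
  exact (continuous_finsetSum _ fun i _ => h1 i).sub
    ((h'.clm_apply continuous_subtype_val).inner continuous_subtype_val)

/-- Leibniz rule. The normal correction produces the extra term df(ζ) ⟨X, ζ⟩, which vanishes by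
tangency. -/
theorem sphereDiv_smul {d : ℕ} {X : Euc (d + 1) → Euc (d + 1)} (hX : ContDiff ℝ ∞ X)
    {f : Euc (d + 1) → ℝ} (hf : ContDiff ℝ ∞ f) (ζ : Sph d)
    (hXt : inner ℝ (X ζ) (ζ : Euc (d + 1)) = 0) :
    sphereDiv (fun x => f x • X x) ζ =
      fderiv ℝ f (ζ : Euc (d + 1)) (X ζ) + f ζ * sphereDiv X ζ := by
  have h := ((hf.differentiable (by simp) (ζ : Euc (d + 1))).hasFDerivAt.smul
    (hX.differentiable (by simp) (ζ : Euc (d + 1))).hasFDerivAt).fderiv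
  have h1 : fderiv ℝ f (ζ : Euc (d + 1)) (X ζ) =
      ∑ i, fderiv ℝ f (ζ : Euc (d + 1)) (EuclideanSpace.single i 1) * X ζ i := by
    conv_lhs => rw [← (EuclideanSpace.basisFun (Fin (d + 1)) ℝ).sum_repr (X ζ)]
    simp [mul_comm]
  unfold sphereDiv
  rw [show (fun x => f x • X x) = f • X from rfl, h, h1]
  simp only [add_apply, smul_apply, ContinuousLinearMap.smulRight_apply, PiLp.add_apply,
    PiLp.smul_apply, smul_eq_mul, inner_add_left, inner_smul_left, hXt, Finset.sum_add_distrib,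
    ← Finset.mul_sum, RCLike.conj_to_real]
  ring

/-- Integration by parts on the sphere, for smooth functions. -/
theorem integral_fderiv_sphere {d : ℕ} {X : Euc (d + 1) → Euc (d + 1)} (hX : ContDiff ℝ ∞ X)
    (hXt : ∀ ζ : Sph d, inner ℝ (X ζ) (ζ : Euc (d + 1)) = 0) {f : Euc (d + 1) → ℝ}
    (hf : ContDiff ℝ ∞ f) :
    ∫ ζ : Sph d, fderiv ℝ f (ζ : Euc (d + 1)) (X ζ) ∂(unif d) =
      -∫ ζ : Sph d, f ζ * sphereDiv X ζ ∂(unif d) := by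
  have h := integral_sphereDiv (d := d) (hf.smul hX) fun ζ => by
    simp [inner_smul_left, hXt ζ]
  have hc1 : Continuous fun ζ : Sph d => fderiv ℝ f (ζ : Euc (d + 1)) (X ζ) :=
    ((hf.continuous_fderiv (by simp)).comp continuous_subtype_val).clm_apply
      (hX.continuous.comp continuous_subtype_val)
  have hc2 : Continuous fun ζ : Sph d => f ζ * sphereDiv X ζ :=
    (hf.continuous.comp continuous_subtype_val).mul (continuous_sphereDiv hX)
  have h2 : ∀ ζ : Sph d, sphereDiv (f • X) ζ =
      fderiv ℝ f (ζ : Euc (d + 1)) (X ζ) + f ζ * sphereDiv X ζ := fun ζ =>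
    sphereDiv_smul hX hf ζ (hXt ζ)
  simp_rw [h2] at h
  rw [integral_add (integrable_unif_of_continuous hc1) (integrable_unif_of_continuous hc2)] at h
  linarith

theorem integrable_inner_of_memLp {d : ℕ} {G : Sph d → Euc (d + 1)} (hG : MemLp G 2 (unif d))
    {X : Sph d → Euc (d + 1)} (hX : Continuous X) :
    Integrable (fun ζ => inner ℝ (G ζ) (X ζ)) (unif d) := by
  obtain ⟨C, hC⟩ := isCompact_univ.exists_bound_of_continuousOn hX.continuousOn
  refine ((hG.integrable one_le_two).norm.mul_const C).mono'
    (hG.1.inner hX.aestronglyMeasurable) (Eventually.of_forall fun ζ => ?_)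
  exact (norm_inner_le_norm _ _).trans
    (mul_le_mul_of_nonneg_left (hC ζ (Set.mem_univ _)) (norm_nonneg _))

/-- A function on the sphere that integrates to zero against all smooth functions vanishes. -/
theorem ae_eq_zero_of_integral_smooth_sphere {d : ℕ} {u : Sph d → ℝ} (hu : Integrable u (unif d))
    (h : ∀ g : Euc (d + 1) → ℝ, ContDiff ℝ ∞ g → ∫ ζ : Sph d, g ζ * u ζ ∂(unif d) = 0) :
    u =ᵐ[unif d] 0 := by
  classical
  have he : MeasurableEmbedding (Subtype.val : Sph d → Euc (d + 1)) :=
    MeasurableEmbedding.subtype_coe Metric.isClosed_sphere.measurableSet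
  set F : Euc (d + 1) → ℝ := fun x =>
    if hx : x ∈ Metric.sphere (0 : Euc (d + 1)) 1 then u ⟨x, hx⟩ else 0 with hF
  have hFu : F ∘ Subtype.val = u := by
    ext ζ
    simp only [Function.comp_apply, hF, dif_pos ζ.2]
  have hFi : Integrable F ((unif d).map Subtype.val) := by
    rw [he.integrable_map_iff, hFu]
    exact hu
  have hz := ae_eq_zero_of_integral_contDiff_smul_eq_zero hFi.locallyIntegrable fun g hg _ => by
    rw [he.integral_map]
    refine (integral_congr_ae (Eventually.of_forall fun ζ => ?_)).trans (h g hg)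
    simp only [smul_eq_mul]
    rw [← hFu]
    rfl
  rw [he.ae_map_iff] at hz
  filter_upwards [hz] with ζ hζ
  rw [← hFu]
  exact hζ

/-- The weak gradient on the sphere is unique. -/
theorem IsSphereWeakGradient.ae_eq {d : ℕ} {u : Sph d → ℝ} {G G' : Sph d → Euc (d + 1)}
    (hG : MemLp G 2 (unif d)) (hG' : MemLp G' 2 (unif d)) (h : IsSphereWeakGradient u G)
    (h' : IsSphereWeakGradient u G') : G =ᵐ[unif d] G' := by
  have hD : MemLp (G - G') 2 (unif d) := hG.sub hG'
  have hDt : ∀ᵐ ζ ∂(unif d), inner ℝ ((G - G') ζ) (ζ : Euc (d + 1)) = 0 := by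
    filter_upwards [h.1, h'.1] with ζ h1 h2
    rw [Pi.sub_apply, inner_sub_left, h1, h2, sub_zero]
  have key : ∀ w : Euc (d + 1), (fun ζ => inner ℝ ((G - G') ζ) w) =ᵐ[unif d] 0 := by
    intro w
    refine ae_eq_zero_of_integral_smooth_sphere
      (integrable_inner_of_memLp hD continuous_const) fun g hg => ?_
    -- On the sphere this is g times the tangential part of w. Paired with the tangent field G - G',
    -- it gives g ⟨G - G', w⟩.
    set X : Euc (d + 1) → Euc (d + 1) := fun x => g x • (w - inner ℝ w x • x) with hXdef
    have hX : ContDiff ℝ ∞ X :=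
      hg.smul (contDiff_const.sub ((contDiff_const.inner ℝ contDiff_id).smul contDiff_id))
    have hXt : ∀ ζ : Sph d, inner ℝ (X ζ) (ζ : Euc (d + 1)) = 0 := fun ζ => by
      have hζ : ‖(ζ : Euc (d + 1))‖ = 1 := norm_eq_of_mem_sphere ζ
      simp [hXdef, inner_smul_left, inner_sub_left, hζ]
    have hXc : Continuous fun ζ : Sph d => X ζ := hX.continuous.comp continuous_subtype_val
    have h0 : ∫ ζ, inner ℝ ((G - G') ζ) (X ζ) ∂(unif d) = 0 := by
      simp_rw [Pi.sub_apply, inner_sub_left]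
      rw [integral_sub (integrable_inner_of_memLp hG hXc) (integrable_inner_of_memLp hG' hXc),
        h.2 X hX hXt, h'.2 X hX hXt, sub_self]
    rw [← h0]
    refine integral_congr_ae ?_
    filter_upwards [hDt] with ζ hζ
    simp only [hXdef, inner_smul_right, inner_sub_right, hζ, mul_zero, sub_zero]
  have hall : ∀ᵐ ζ ∂(unif d), ∀ i : Fin (d + 1), inner ℝ ((G - G') ζ) (EuclideanSpace.single i 1) = (0 : ℝ) :=
    ae_all_iff.2 fun i => key _
  filter_upwards [hall] with ζ hζ
  ext i
  have := hζ i
  simp only [EuclideanSpace.inner_single_right, Pi.sub_apply, PiLp.sub_apply] at this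
  simpa [sub_eq_zero] using this

theorem sphereWeakGradient_spec {d : ℕ} {u : Sph d → ℝ} {G : Sph d → Euc (d + 1)}
    (hG : MemLp G 2 (unif d)) (h : IsSphereWeakGradient u G) :
    sphereWeakGradient u =ᵐ[unif d] G := by
  have hex : ∃ G : Sph d → Euc (d + 1), MemLp G 2 (unif d) ∧ IsSphereWeakGradient u G :=
    ⟨G, hG, h⟩
  rw [sphereWeakGradient, dif_pos hex]
  exact IsSphereWeakGradient.ae_eq hex.choose_spec.1 hG hex.choose_spec.2 h

theorem weakGradient_spec {n : ℕ} {v : Euc n → ℝ} (hv : MemH1 v) :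
    MemLp (weakGradient v) 2 volume ∧ IsWeakGradient v (weakGradient v) := by
  rw [weakGradient, dif_pos hv.2]
  exact hv.2.choose_spec

/-! ### Mollification of compactly supported H¹ functions -/

section Mollify

open ContinuousLinearMap (lsmul)
open scoped Convolution

variable {n : ℕ} {F : Type*} [NormedAddCommGroup F]

theorem enorm_sq_eLpNorm_two {α : Type*} [MeasurableSpace α] (μ : Measure α) (f : α → F) :
    eLpNorm f 2 μ ^ 2 = ∫⁻ x, ‖f x‖ₑ ^ 2 ∂μ := by
  have h := eLpNorm_nnreal_pow_eq_lintegral (μ := μ) (f := f) (p := 2) two_ne_zero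
  simp only [NNReal.coe_ofNat, ENNReal.rpow_ofNat] at h
  exact h

/-- Continuity of the action of translations on L². -/
theorem tendsto_eLpNorm_translate {f : Euc n → F} (hf : MemLp f 2 volume) :
    Tendsto (fun t : Euc n => eLpNorm (fun x => f (x - t) - f x) 2 volume) (𝓝 0) (𝓝 0) := by
  have : Fact ((1 : ℝ≥0∞) ≤ 2) := ⟨one_le_two⟩
  have : Fact ((2 : ℝ≥0∞) ≠ ⊤) := ⟨ENNReal.ofNat_ne_top⟩
  have hc : Continuous fun t : Euc n => DomAddAct.mk (-t) +ᵥ hf.toLp f := by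
    have : Continuous fun t : Euc n => DomAddAct.mk (-t) :=
      DomAddAct.mkHomeomorph.continuous.comp continuous_neg
    exact this.vadd continuous_const
  have h := (hc.tendsto 0)
  rw [tendsto_iff_edist_tendsto_0] at h
  refine h.congr fun t => ?_
  simp only [neg_zero, DomAddAct.mk_zero, zero_vadd]
  rw [DomAddAct.mk_vadd_toLp, Lp.edist_toLp_toLp]
  congr 1
  ext x
  simp [sub_eq_neg_add]

variable [NormedSpace ℝ F]

/-- The mollifier is a probability density, so the left side is the squared norm of a mean of f(x -
t) - f(x); an L¹ norm is at most the L² norm for a probability measure. -/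
theorem enorm_sq_convolution_sub_le {f : Euc n → F} (hf : MemLp f 2 volume)
    (φ : ContDiffBump (0 : Euc n)) (x : Euc n) [CompleteSpace F] :
    ‖(φ.normed volume ⋆[lsmul ℝ ℝ, volume] f) x - f x‖ₑ ^ 2 ≤
      ∫⁻ t, ENNReal.ofReal (φ.normed volume t) * ‖f (x - t) - f x‖ₑ ^ 2 := by
  set ρ := φ.normed volume
  have hρm : Measurable ρ := φ.continuous_normed.measurable
  have hloc : LocallyIntegrable f volume := hf.locallyIntegrable one_le_two
  have hex : Integrable (fun t => ρ t • f (x - t)) volume := (φ.hasCompactSupport_normed (μ := volume)).convolutionExists_left (μ := volume) (lsmul ℝ ℝ)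
    φ.continuous_normed hloc x
  have hsub : (ρ ⋆[lsmul ℝ ℝ, volume] f) x - f x = ∫ t, ρ t • (f (x - t) - f x) := by
    simp_rw [smul_sub]
    rw [integral_sub hex ((φ.integrable_normed (μ := volume)).smul_const _),
      φ.integral_normed_smul volume (f x)]
    rfl
  set P : Measure (Euc n) := volume.withDensity fun t => ENNReal.ofReal (ρ t)
  have hP : IsProbabilityMeasure P := ⟨by
    rw [withDensity_apply _ MeasurableSet.univ, Measure.restrict_univ,
      ← ofReal_integral_eq_lintegral_ofReal φ.integrable_normed
        (Eventually.of_forall φ.nonneg_normed), φ.integral_normed, ENNReal.ofReal_one]⟩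
  have hfm : AEStronglyMeasurable (fun t => f (x - t) - f x) volume :=
    (hf.1.comp_measurePreserving (volume.measurePreserving_sub_left x)).sub
      aestronglyMeasurable_const
  have hPm : AEStronglyMeasurable (fun t => f (x - t) - f x) P :=
    hfm.mono_ac (withDensity_absolutelyContinuous _ _)
  have h1 : ‖(ρ ⋆[lsmul ℝ ℝ, volume] f) x - f x‖ₑ ≤ eLpNorm (fun t => f (x - t) - f x) 1 P := by
    rw [hsub, eLpNorm_one_eq_lintegral_enorm, lintegral_withDensity_eq_lintegral_mul₀'
      hρm.ennreal_ofReal.aemeasurable hPm.enorm]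
    refine (enorm_integral_le_lintegral_enorm _).trans_eq (lintegral_congr fun t => ?_)
    rw [enorm_smul, Real.enorm_of_nonneg (φ.nonneg_normed t)]
    rfl
  calc _ ≤ eLpNorm (fun t => f (x - t) - f x) 2 P ^ 2 :=
        pow_le_pow_left' (h1.trans (eLpNorm_le_eLpNorm_of_exponent_le one_le_two hPm)) 2
    _ = _ := by
        rw [enorm_sq_eLpNorm_two, lintegral_withDensity_eq_lintegral_mul₀'
          hρm.ennreal_ofReal.aemeasurable (hPm.enorm.pow_const 2)]
        rfl

theorem eLpNorm_convolution_sub_le {f : Euc n → F} (hf : MemLp f 2 volume)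
    (φ : ContDiffBump (0 : Euc n)) [CompleteSpace F] {ε : ℝ≥0∞}
    (hε : ∀ t ∈ Metric.ball (0 : Euc n) φ.rOut,
      eLpNorm (fun x => f (x - t) - f x) 2 volume ≤ ε) :
    eLpNorm (φ.normed volume ⋆[lsmul ℝ ℝ, volume] f - f) 2 volume ≤ ε := by
  -- Tonelli's theorem below needs f(x - t) - f(x) to be jointly measurable. Changing f on a null
  -- set affects neither the convolution nor the norms.
  wlog hfs : StronglyMeasurable f generalizing f
  · have hmk := hf.1.ae_eq_mk
    have hmk' : MemLp (hf.1.mk f) 2 volume := (memLp_congr_ae hmk).1 hf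
    have hconv : φ.normed volume ⋆[lsmul ℝ ℝ, volume] f =
        φ.normed volume ⋆[lsmul ℝ ℝ, volume] (hf.1.mk f) :=
      convolution_congr _ (ae_eq_refl _) hmk
    rw [hconv, eLpNorm_congr_ae ((ae_eq_refl _).sub hmk)]
    refine this hmk' (fun t ht => ?_) hf.1.stronglyMeasurable_mk
    refine le_of_eq_of_le (eLpNorm_congr_ae ?_) (hε t ht)
    have h2 := (measurePreserving_sub_right volume t).quasiMeasurePreserving.ae_eq_comp hmk
    filter_upwards [hmk, h2] with x h1 h2
    simp only [Function.comp_apply] at h2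
    rw [h1, h2]
  rw [← ENNReal.pow_le_pow_left_iff two_ne_zero]
  rw [enorm_sq_eLpNorm_two]
  set ρ := φ.normed volume
  have hρm : Measurable ρ := φ.continuous_normed.measurable
  calc ∫⁻ x, ‖(ρ ⋆[lsmul ℝ ℝ, volume] f - f) x‖ₑ ^ 2
      ≤ ∫⁻ x, ∫⁻ t, ENNReal.ofReal (ρ t) * ‖f (x - t) - f x‖ₑ ^ 2 :=
        lintegral_mono fun x => enorm_sq_convolution_sub_le hf φ x
    _ = ∫⁻ t, ∫⁻ x, ENNReal.ofReal (ρ t) * ‖f (x - t) - f x‖ₑ ^ 2 := by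
        refine lintegral_lintegral_swap (Measurable.aemeasurable ?_)
        have h1 : StronglyMeasurable fun p : Euc n × Euc n => f (p.1 - p.2) - f p.1 :=
          (hfs.comp_measurable (measurable_fst.sub measurable_snd)).sub
            (hfs.comp_measurable measurable_fst)
        exact (hρm.comp measurable_snd).ennreal_ofReal.mul (h1.enorm.pow_const 2)
    _ ≤ ∫⁻ t, ENNReal.ofReal (ρ t) * ε ^ 2 := by
        refine lintegral_mono fun t => ?_
        simp only
        rw [lintegral_const_mul' _ _ ENNReal.ofReal_ne_top, ← enorm_sq_eLpNorm_two]
        by_cases ht : t ∈ Metric.ball (0 : Euc n) φ.rOut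
        · gcongr
          exact hε t ht
        · have : ρ t = 0 := by
            rw [← Function.notMem_support, φ.support_normed_eq]
            exact ht
          simp [this]
    _ = ε ^ 2 := by
        rw [lintegral_mul_const _ hρm.ennreal_ofReal,
          ← ofReal_integral_eq_lintegral_ofReal φ.integrable_normed
          (Eventually.of_forall φ.nonneg_normed), φ.integral_normed, ENNReal.ofReal_one, one_mul]

/-- Mollifications converge in `L²`. -/
theorem tendsto_eLpNorm_convolution_sub {f : Euc n → F} (hf : MemLp f 2 volume)
    [CompleteSpace F] {φ : ℕ → ContDiffBump (0 : Euc n)}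
    (hφ : Tendsto (fun k => (φ k).rOut) atTop (𝓝 0)) :
    Tendsto (fun k => eLpNorm ((φ k).normed volume ⋆[lsmul ℝ ℝ, volume] f - f) 2 volume)
      atTop (𝓝 0) := by
  rw [ENNReal.tendsto_nhds_zero]
  intro ε hε
  have h := ENNReal.tendsto_nhds_zero.1 (tendsto_eLpNorm_translate hf) ε hε
  obtain ⟨δ, hδ, hball⟩ := Metric.eventually_nhds_iff_ball.1 h
  filter_upwards [hφ.eventually_lt_const hδ] with k hk
  exact eLpNorm_convolution_sub_le hf (φ k) fun t ht =>
    hball t (Metric.ball_subset_ball hk.le ht)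

/-- The gradient of a mollification is the mollification of the weak gradient. -/
theorem gradient_convolution {v : Euc n → ℝ} {g : Euc n → Euc n} (hv : MemLp v 2 volume)
    (hg : MemLp g 2 volume) (hw : IsWeakGradient v g) (φ : ContDiffBump (0 : Euc n)) :
    gradient (φ.normed volume ⋆[lsmul ℝ ℝ, volume] v) =
      φ.normed volume ⋆[lsmul ℝ ℝ, volume] g := by
  ext1 x
  set ρ := φ.normed volume
  have hρ : ContDiff ℝ ∞ ρ := φ.contDiff_normed
  have hρ1 : ContDiff ℝ 1 ρ := φ.contDiff_normed
  have hvl : LocallyIntegrable v volume := hv.locallyIntegrable one_le_two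
  have hgl : LocallyIntegrable g volume := hg.locallyIntegrable one_le_two
  have hs : HasCompactSupport ρ := φ.hasCompactSupport_normed
  refine ext_inner_right ℝ fun w => ?_
  have hexg := hs.convolutionExists_left (μ := volume) (lsmul ℝ ℝ) φ.continuous_normed hgl x
  have hexv := (hs.fderiv ℝ).convolutionExists_left (μ := volume)
    ((lsmul ℝ ℝ).precompL (Euc n)) (hρ1.continuous_fderiv one_ne_zero) hvl x
  have hfd := (hs.hasFDerivAt_convolution_left (lsmul ℝ ℝ) hρ1 hvl x).fderiv
  rw [gradient, InnerProductSpace.toDual_symm_apply, hfd, convolution_def,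
    ContinuousLinearMap.integral_apply hexv]
  simp only [ContinuousLinearMap.precompL_apply, ContinuousLinearMap.lsmul_apply, smul_eq_mul]
  -- The test function in the definition of the weak gradient is the mollifier reflected and centred
  -- at x.
  have hψ : ContDiff ℝ ∞ fun y => ρ (x - y) := hρ.comp (contDiff_const.sub contDiff_id)
  have hψs : HasCompactSupport fun y => ρ (x - y) :=
    hs.comp_homeomorph (Homeomorph.subLeft x)
  have hψd : ∀ y, fderiv ℝ (fun y => ρ (x - y)) y w = -fderiv ℝ ρ (x - y) w := by
    intro y
    have h1 : HasFDerivAt (fun y => ρ (x - y)) _ y :=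
      HasFDerivAt.comp (g := ρ) (f := fun y => x - y) y
        (hρ1.differentiable one_ne_zero (x - y)).hasFDerivAt ((hasFDerivAt_id y).const_sub x)
    rw [h1.fderiv]
    simp
  have h1 := hw _ hψ hψs w
  simp_rw [hψd, mul_neg] at h1
  rw [integral_neg, neg_inj] at h1
  have h2 : ∫ t, fderiv ℝ ρ t w * v (x - t) = ∫ y, v y * fderiv ℝ ρ (x - y) w := by
    rw [← integral_sub_left_eq_self (fun t => fderiv ℝ ρ t w * v (x - t)) volume x]
    simp [mul_comm]
  rw [h2, h1, convolution_eq_swap]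
  simp only [ContinuousLinearMap.lsmul_apply]
  have hint : Integrable (fun t => ρ (x - t) • g t) volume := by
    have := hexg.integrable_swap
    simpa using this
  rw [real_inner_comm, ← integral_inner hint]
  refine integral_congr_ae (Eventually.of_forall fun y => ?_)
  simp only [inner_smul_right, real_inner_comm w, mul_comm]

/-- Approximation of a compactly supported `H¹` function by smooth functions with supports in a
fixed ball. -/
theorem exists_smooth_approx {v : Euc n → ℝ} {g : Euc n → Euc n} (hv : MemLp v 2 volume)
    (hg : MemLp g 2 volume) (hw : IsWeakGradient v g) {R : ℝ}
    (hR : ∀ᵐ x, x ∉ Metric.closedBall (0 : Euc n) R → v x = 0) :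
    ∃ φ : ℕ → Euc n → ℝ, (∀ k, ContDiff ℝ ∞ (φ k)) ∧
      (∀ k, ∀ x ∉ Metric.closedBall (0 : Euc n) (R + 1), φ k x = 0) ∧
      Tendsto (fun k => eLpNorm (φ k - v) 2 volume) atTop (𝓝 0) ∧
      Tendsto (fun k => eLpNorm (gradient (φ k) - g) 2 volume) atTop (𝓝 0) := by
  -- The outer radius 1/(k+1) is at most 1, so that all supports stay in the ball of radius R + 1.
  let β : ℕ → ContDiffBump (0 : Euc n) := fun k =>
    ⟨1 / (2 * (k + 1)), 1 / (k + 1), by positivity, by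
      rw [one_div, one_div]
      exact inv_strictAnti₀ (by positivity) (by linarith [(Nat.cast_nonneg k : (0 : ℝ) ≤ k)])⟩
  have hβ : Tendsto (fun k => (β k).rOut) atTop (𝓝 0) := tendsto_one_div_add_atTop_nhds_zero_nat
  refine ⟨fun k => (β k).normed volume ⋆[lsmul ℝ ℝ, volume] v, fun k => ?_, fun k x hx => ?_,
    tendsto_eLpNorm_convolution_sub hv hβ, ?_⟩
  · exact (β k).hasCompactSupport_normed.contDiff_convolution_left (n := ⊤) _
      (β k).contDiff_normed (hv.locallyIntegrable one_le_two)
  · refine integral_eq_zero_of_ae ?_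
    have hq := (volume.measurePreserving_sub_left x).quasiMeasurePreserving.ae hR
    filter_upwards [hq] with t ht
    simp only [ContinuousLinearMap.lsmul_apply, Pi.zero_apply]
    by_cases hts : t ∈ Metric.ball (0 : Euc n) (β k).rOut
    · rw [ht, smul_zero]
      intro hxt
      have h1 : ‖t‖ < 1 / ((k : ℝ) + 1) := mem_ball_zero_iff.1 hts
      have h2 : 1 / ((k : ℝ) + 1) ≤ 1 := by
        rw [div_le_one (by positivity)]
        linarith [(Nat.cast_nonneg k : (0 : ℝ) ≤ k)]
      have h3 : ‖x - t‖ ≤ R := by simpa using hxt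
      refine hx ?_
      rw [mem_closedBall_zero_iff]
      calc ‖x‖ = ‖(x - t) + t‖ := by rw [sub_add_cancel]
        _ ≤ ‖x - t‖ + ‖t‖ := norm_add_le _ _
        _ ≤ R + 1 := by linarith
    · rw [← (β k).support_normed_eq (μ := volume), Function.notMem_support] at hts
      rw [hts, zero_smul]
  · simp_rw [gradient_convolution hv hg hw]
    exact tendsto_eLpNorm_convolution_sub hg hβ

end Mollify

/-! ### Gain of integrability -/

theorem enorm_le_lintegral_fderiv_of_dim_one {u : Euc 1 → ℝ} (hu : ContDiff ℝ 1 u)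
    (hs : HasCompactSupport u) (x : Euc 1) : ‖u x‖ₑ ≤ ∫⁻ y, ‖fderiv ℝ u y‖ₑ := by
  set e : Euc 1 := EuclideanSpace.single 0 1
  have he : ‖e‖ = 1 := by simp [e]
  have he0 : e ≠ 0 := norm_ne_zero_iff.1 (by simp [he])
  have hx : x = x 0 • e := by
    ext i
    fin_cases i
    simp [e]
  have hf : ContDiff ℝ 1 fun t : ℝ => u (t • e) := by fun_prop
  have hfs : HasCompactSupport fun t : ℝ => u (t • e) :=
    hs.comp_isClosedEmbedding (isClosedEmbedding_smul_left he0)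
  have hvol : (volume : Measure (Euc 1)) = (volume : Measure ℝ).map fun t => t • e := by
    rw [volume_eq_of_finrank_eq_one (by simp) he0, ← ofReal_norm, he, ENNReal.ofReal_one, one_smul]
  calc ‖u x‖ₑ ≤ ∫⁻ t in Set.Iic (x 0), ‖deriv (fun t : ℝ => u (t • e)) t‖ₑ := by
        conv_lhs => rw [hx]
        exact HasCompactSupport.enorm_le_lintegral_Ici_deriv hf hfs (x 0)
    _ ≤ ∫⁻ t : ℝ, ‖deriv (fun t : ℝ => u (t • e)) t‖ₑ := setLIntegral_le_lintegral _ _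
    _ ≤ ∫⁻ t : ℝ, ‖fderiv ℝ u (t • e)‖ₑ := by
        refine lintegral_mono fun t => ?_
        have h1 : HasDerivAt (fun t : ℝ => u (t • e)) (fderiv ℝ u (t • e) ((1 : ℝ) • e)) t :=
          (hu.differentiable one_ne_zero (t • e)).hasFDerivAt.comp_hasDerivAt t
            ((hasDerivAt_id t).smul_const e)
        simp only
        rw [h1.deriv, one_smul, ← ofReal_norm, ← ofReal_norm]
        refine ENNReal.ofReal_le_ofReal ?_
        simpa [he] using (fderiv ℝ u (t • e)).le_opNorm e
    _ = ∫⁻ y, ‖fderiv ℝ u y‖ₑ := by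
        rw [hvol, lintegral_map (hu.continuous_fderiv one_ne_zero).enorm.measurable (by fun_prop)]

/-- From ∇(φ²) = 2 φ ∇φ and 2ab ≤ a² + b². It lets L¹ Sobolev inequalities, applied to φ², be
controlled by the H¹ norm. -/
theorem lintegral_fderiv_sq_le {n : ℕ} {φ : Euc n → ℝ} (hφ : ContDiff ℝ 1 φ) :
    ∫⁻ x, ‖fderiv ℝ (fun y => φ y ^ 2) x‖ₑ ≤
      (∫⁻ x, ‖φ x‖ₑ ^ 2) + ∫⁻ x, ‖fderiv ℝ φ x‖ₑ ^ 2 := by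
  rw [← lintegral_add_left (hφ.continuous.enorm.measurable.pow_const 2)]
  refine lintegral_mono fun x => ?_
  have h1 : fderiv ℝ (fun y => φ y ^ 2) x = (2 * φ x) • fderiv ℝ φ x := by
    rw [((hφ.differentiable one_ne_zero x).hasFDerivAt.pow 2).fderiv]
    simp
  simp only
  rw [h1, ← ofReal_norm, ← ofReal_norm, ← ofReal_norm, ← ENNReal.ofReal_pow (norm_nonneg _),
    ← ENNReal.ofReal_pow (norm_nonneg _), ← ENNReal.ofReal_add (by positivity) (by positivity),
    norm_smul, norm_mul, Real.norm_ofNat]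
  exact ENNReal.ofReal_le_ofReal (two_mul_le_add_sq _ _)

/-- A weak form of the Sobolev inequality: a gain of integrability for `C¹` functions. -/
theorem exists_lintegral_rpow_bound {n : ℕ} (hn : 1 ≤ n) :
    ∃ q : ℝ, 2 < q ∧ ∀ A : ℝ≥0∞, A ≠ ⊤ → ∃ B : ℝ≥0∞, B ≠ ⊤ ∧ ∀ φ : Euc n → ℝ, ContDiff ℝ 1 φ →
      HasCompactSupport φ → ∫⁻ x, ‖φ x‖ₑ ^ 2 ≤ A → ∫⁻ x, ‖fderiv ℝ φ x‖ₑ ^ 2 ≤ A →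
      ∫⁻ x, ‖φ x‖ₑ ^ q ≤ B := by
  have hsq : ∀ {φ : Euc n → ℝ}, HasCompactSupport φ → HasCompactSupport fun y => φ y ^ 2 :=
    fun hφs => hφs.comp_left (g := fun t : ℝ => t ^ 2) (by simp)
  rcases hn.eq_or_lt with rfl | hn2
  -- In dimension one, φ² is bounded by the L¹ norm of its derivative, and φ⁴ ≤ sup(φ²) φ².
  · refine ⟨4, by norm_num, fun A hA => ⟨(A + A) * A, by finiteness, fun φ hφ hφs h1 h2 => ?_⟩⟩
    calc ∫⁻ x, ‖φ x‖ₑ ^ (4 : ℝ) ≤ ∫⁻ x, (A + A) * ‖φ x‖ₑ ^ 2 := by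
          refine lintegral_mono fun x => ?_
          have h3 := (enorm_le_lintegral_fderiv_of_dim_one (hφ.pow 2) (hsq hφs) x).trans
            ((lintegral_fderiv_sq_le hφ).trans (add_le_add h1 h2))
          rw [enorm_pow] at h3
          calc ‖φ x‖ₑ ^ (4 : ℝ) = ‖φ x‖ₑ ^ 2 * ‖φ x‖ₑ ^ 2 := by
                rw [← pow_add]
                exact_mod_cast ENNReal.rpow_natCast _ 4
            _ ≤ (A + A) * ‖φ x‖ₑ ^ 2 := by gcongr
      _ = (A + A) * ∫⁻ x, ‖φ x‖ₑ ^ 2 := lintegral_const_mul' _ _ (by finiteness)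
      _ ≤ (A + A) * A := by gcongr
  · have hn1 : (1 : ℝ) < n := by exact_mod_cast hn2
    have hp : Real.HolderConjugate (Module.finrank ℝ (Euc n)) (Real.conjExponent n) := by
      rw [finrank_euclideanSpace_fin]
      exact Real.HolderConjugate.conjExponent hn1
    -- The embedding of W^{1,1} into L^p with p = n/(n-1), applied to φ², gives q = 2p > 2.
    set p := Real.conjExponent n
    have hp1 : 1 < p := hp.symm.lt
    refine ⟨2 * p, by linarith, fun A hA =>
      ⟨lintegralPowLePowLIntegralFDerivConst (volume : Measure (Euc n)) p * (A + A) ^ p, ?_,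
        fun φ hφ hφs h1 h2 => ?_⟩⟩
    · exact ENNReal.mul_ne_top ENNReal.coe_ne_top
        (ENNReal.rpow_ne_top_of_nonneg (by linarith) (by finiteness))
    · have h3 := lintegral_pow_le_pow_lintegral_fderiv (μ := (volume : Measure (Euc n)))
        (hφ.pow 2) (hsq hφs) hp
      calc ∫⁻ x, ‖φ x‖ₑ ^ (2 * p) = ∫⁻ x, ‖φ x ^ 2‖ₑ ^ p := by
            refine lintegral_congr fun x => ?_
            rw [enorm_pow, ENNReal.rpow_mul, ENNReal.rpow_ofNat]
        _ ≤ _ := h3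
        _ ≤ _ := by
          gcongr
          exact (lintegral_fderiv_sq_le hφ).trans (add_le_add h1 h2)

theorem norm_gradient {n : ℕ} (φ : Euc n → ℝ) (x : Euc n) : ‖gradient φ x‖ = ‖fderiv ℝ φ x‖ := by
  rw [gradient, LinearIsometryEquiv.norm_map]

/-- Compactly supported `H¹` functions belong to some `L^q` with `q > 2`. -/
theorem exists_memLp_gt_two {n : ℕ} (hn : 1 ≤ n) {v : Euc n → ℝ} {g : Euc n → Euc n}
    (hv : MemLp v 2 volume) (hg : MemLp g 2 volume) (hw : IsWeakGradient v g) {R : ℝ}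
    (hR : ∀ᵐ x, x ∉ Metric.closedBall (0 : Euc n) R → v x = 0) :
    ∃ q : ℝ, 2 < q ∧ MemLp v (ENNReal.ofReal q) volume := by
  obtain ⟨φ, hφ, hφs, hφv, hφg⟩ := exists_smooth_approx hv hg hw hR
  obtain ⟨q, hq, hbd⟩ := exists_lintegral_rpow_bound hn
  refine ⟨q, hq, hv.1, ?_⟩
  have hφm : ∀ k, AEStronglyMeasurable (φ k) volume := fun k => (hφ k).continuous.aestronglyMeasurable
  have hgm : ∀ k, AEStronglyMeasurable (gradient (φ k)) volume := fun k =>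
    (((InnerProductSpace.toDual ℝ (Euc n)).symm.continuous.comp
      ((hφ k).continuous_fderiv (by simp)))).aestronglyMeasurable
  have hv0 : eLpNorm v 2 volume ≠ ⊤ := hv.2.ne
  have hg0 : eLpNorm g 2 volume ≠ ⊤ := hg.2.ne
  set A := (1 + eLpNorm v 2 volume) ^ 2 + (1 + eLpNorm g 2 volume) ^ 2
  obtain ⟨B, hB, hle⟩ := hbd A (by finiteness)
  have hev : ∀ᶠ k in atTop, ∫⁻ x, ‖φ k x‖ₑ ^ q ≤ B := by
    filter_upwards [ENNReal.tendsto_nhds_zero.1 hφv 1 one_pos,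
      ENNReal.tendsto_nhds_zero.1 hφg 1 one_pos] with k h1 h2
    refine hle (φ k) ((hφ k).of_le (by simp)) (HasCompactSupport.intro
      (isCompact_closedBall 0 (R + 1)) (hφs k)) ?_ ?_
    · rw [← enorm_sq_eLpNorm_two]
      refine le_trans (pow_le_pow_left' ?_ 2) le_self_add
      calc eLpNorm (φ k) 2 volume = eLpNorm ((φ k - v) + v) 2 volume := by rw [sub_add_cancel]
        _ ≤ eLpNorm (φ k - v) 2 volume + eLpNorm v 2 volume :=
            eLpNorm_add_le ((hφm k).sub hv.1) hv.1 one_le_two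
        _ ≤ _ := by gcongr
    · have h3 : ∫⁻ x, ‖fderiv ℝ (φ k) x‖ₑ ^ 2 = ∫⁻ x, ‖gradient (φ k) x‖ₑ ^ 2 := by
        refine lintegral_congr fun x => ?_
        rw [← ofReal_norm, ← ofReal_norm, norm_gradient]
      rw [h3, ← enorm_sq_eLpNorm_two]
      refine le_trans (pow_le_pow_left' ?_ 2) le_add_self
      calc eLpNorm (gradient (φ k)) 2 volume
            = eLpNorm ((gradient (φ k) - g) + g) 2 volume := by rw [sub_add_cancel]
        _ ≤ eLpNorm (gradient (φ k) - g) 2 volume + eLpNorm g 2 volume :=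
            eLpNorm_add_le ((hgm k).sub hg.1) hg.1 one_le_two
        _ ≤ _ := by gcongr
  -- The L^q bound passes from the mollifications to v by Fatou's lemma along an almost everywhere
  -- convergent subsequence.
  obtain ⟨ns, hns, hae⟩ := (tendstoInMeasure_of_tendsto_eLpNorm two_ne_zero hφm hv.1
    hφv).exists_seq_tendsto_ae
  have hq0 : 0 < q := by linarith
  have hfin : ∫⁻ x, ‖v x‖ₑ ^ q ≤ B := by
    calc ∫⁻ x, ‖v x‖ₑ ^ q = ∫⁻ x, liminf (fun i => ‖φ (ns i) x‖ₑ ^ q) atTop := by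
          refine lintegral_congr_ae ?_
          filter_upwards [hae] with x hx
          exact ((ENNReal.continuous_rpow_const.tendsto _).comp hx.enorm).liminf_eq.symm
      _ ≤ liminf (fun i => ∫⁻ x, ‖φ (ns i) x‖ₑ ^ q) atTop :=
          lintegral_liminf_le fun i =>
            ((hφ (ns i)).continuous.enorm.measurable).pow_const q
      _ ≤ B := liminf_le_of_le (by isBoundedDefault) fun b hb => by
          obtain ⟨i, h1, h2⟩ := (hb.and (hns.tendsto_atTop.eventually hev)).exists
          exact h1.trans h2
  rw [eLpNorm_lt_top_iff_lintegral_rpow_enorm_lt_top (by simpa using hq0) ENNReal.ofReal_ne_top,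
    ENNReal.toReal_ofReal hq0.le]
  exact hfin.trans_lt hB.lt_top

/-- The weak gradient of a compactly supported function is compactly supported. -/
theorem IsWeakGradient.ae_eq_zero_of_notMem {n : ℕ} {v : Euc n → ℝ} {g : Euc n → Euc n}
    (hv : MemLp v 2 volume) (hg : MemLp g 2 volume) (hw : IsWeakGradient v g) {R : ℝ}
    (hR : ∀ᵐ x, x ∉ Metric.closedBall (0 : Euc n) R → v x = 0) :
    ∀ᵐ x, x ∉ Metric.closedBall (0 : Euc n) (R + 1) → g x = 0 := by
  obtain ⟨φ, hφ, hφs, hφv, hφg⟩ := exists_smooth_approx hv hg hw hR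
  have hgm : ∀ k, AEStronglyMeasurable (gradient (φ k)) volume := fun k =>
    (((InnerProductSpace.toDual ℝ (Euc n)).symm.continuous.comp
      ((hφ k).continuous_fderiv (by simp)))).aestronglyMeasurable
  obtain ⟨ns, hns, hae⟩ := (tendstoInMeasure_of_tendsto_eLpNorm two_ne_zero hgm hg.1
    hφg).exists_seq_tendsto_ae
  filter_upwards [hae] with x hx hxR
  have h0 : ∀ k, gradient (φ k) x = 0 := by
    intro k
    have : φ k =ᶠ[𝓝 x] fun _ => 0 := by
      filter_upwards [Metric.isClosed_closedBall.isOpen_compl.mem_nhds hxR] with y hy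
      exact hφs k y hy
    rw [gradient, this.fderiv_eq]
    simp
  simp only [h0] at hx
  exact (tendsto_nhds_unique hx tendsto_const_nhds)

theorem lpNorm_two_sq {α E : Type*} [MeasurableSpace α] [NormedAddCommGroup E] {μ : Measure α}
    {f : α → E} (hf : AEStronglyMeasurable f μ) :
    lpNorm f 2 μ ^ 2 = ∫ x, ‖f x‖ ^ 2 ∂μ := by
  rw [lpNorm_eq_integral_norm_rpow_toReal two_ne_zero ENNReal.ofNat_ne_top hf]
  simp only [ENNReal.toReal_ofNat, Real.rpow_ofNat]
  rw [← Real.rpow_natCast, ← Real.rpow_mul (integral_nonneg fun x => by positivity)]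
  norm_num

/-! ### The weak gradient of the lifted function and its energy -/

section

variable {n d : ℕ}

theorem adjoint_scaledCoords_apply (hd : n ≤ d) (w : Euc n) (i : Fin n) :
    (scaledCoords n d).adjoint w ⟨i, by omega⟩ = √d * w i := by
  have h1 : (scaledCoords n d).adjoint w ⟨i, by omega⟩ = inner ℝ
      (EuclideanSpace.single (⟨i, by omega⟩ : Fin (d + 1)) (1 : ℝ))
      ((scaledCoords n d).adjoint w) := by
    simp [EuclideanSpace.inner_single_left]
  have h2 : scaledCoords n d (EuclideanSpace.single (⟨i, by omega⟩ : Fin (d + 1)) (1 : ℝ)) =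
      √(d : ℝ) • EuclideanSpace.single i (1 : ℝ) := by
    ext j
    rw [scaledCoords_apply hd]
    by_cases hj : j = i
    · simp [hj]
    · have : (j : ℕ) ≠ i := fun h => hj (Fin.ext h)
      simp [hj, this]
  rw [h1, ContinuousLinearMap.adjoint_inner_right, h2, inner_smul_left]
  simp [EuclideanSpace.inner_single_left]

/-- For T = `scaledCoords n d` and n ≤ d one has T T* = d Id. This is the factor d that the
normalization 1/d compensates. -/
theorem norm_sq_adjoint_scaledCoords (hd : n ≤ d) (w : Euc n) :
    ‖(scaledCoords n d).adjoint w‖ ^ 2 = d * ‖w‖ ^ 2 := by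
  have h1 : scaledCoords n d ((scaledCoords n d).adjoint w) = (d : ℝ) • w := by
    ext i
    rw [scaledCoords_apply hd, adjoint_scaledCoords_apply hd, ← mul_assoc,
      Real.mul_self_sqrt (Nat.cast_nonneg d)]
    rfl
  rw [← real_inner_self_eq_norm_sq, ContinuousLinearMap.adjoint_inner_left, h1, inner_smul_right,
    real_inner_self_eq_norm_sq]

/-- The tangential gradient on the sphere of `v ∘ scaledCoords n d`, where `g` is the gradient
of `v`. -/
def liftGradient (g : Euc n → Euc n) (d : ℕ) (ζ : Sph d) : Euc (d + 1) :=
  (scaledCoords n d).adjoint (g (scaledCoords n d ζ)) -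
    (inner ℝ (g (scaledCoords n d ζ)) (scaledCoords n d ζ) : ℝ) • (ζ : Euc (d + 1))

theorem inner_liftGradient (g : Euc n → Euc n) (ζ : Sph d) {x : Euc (d + 1)}
    (hx : inner ℝ x (ζ : Euc (d + 1)) = 0) :
    inner ℝ (liftGradient g d ζ) x = inner ℝ (g (scaledCoords n d ζ)) (scaledCoords n d x) := by
  rw [liftGradient, inner_sub_left, ContinuousLinearMap.adjoint_inner_left, inner_smul_left,
    real_inner_comm x, hx, mul_zero, sub_zero]

theorem inner_liftGradient_self (g : Euc n → Euc n) (ζ : Sph d) :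
    inner ℝ (liftGradient g d ζ) (ζ : Euc (d + 1)) = 0 := by
  have hζ : ‖(ζ : Euc (d + 1))‖ = 1 := norm_eq_of_mem_sphere ζ
  rw [liftGradient, inner_sub_left, ContinuousLinearMap.adjoint_inner_left, inner_smul_left,
    real_inner_self_eq_norm_sq, hζ]
  simp

/-- Pythagoras: the second term is the square of the removed normal component. It carries no factor
d, hence does not contribute to the limit. -/
theorem norm_sq_liftGradient (hd : n ≤ d) (g : Euc n → Euc n) (ζ : Sph d) :
    ‖liftGradient g d ζ‖ ^ 2 = d * ‖g (scaledCoords n d ζ)‖ ^ 2 -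
      (inner ℝ (g (scaledCoords n d ζ)) (scaledCoords n d ζ)) ^ 2 := by
  have hζ : ‖(ζ : Euc (d + 1))‖ = 1 := norm_eq_of_mem_sphere ζ
  rw [liftGradient, norm_sub_sq_real, norm_sq_adjoint_scaledCoords hd, inner_smul_right,
    ContinuousLinearMap.adjoint_inner_left, norm_smul, hζ, mul_one, Real.norm_eq_abs, sq_abs]
  ring

theorem aestronglyMeasurable_liftGradient (hd : 2 * (n + 1) ≤ d) {g : Euc n → Euc n}
    (hg : AEStronglyMeasurable g volume) :
    AEStronglyMeasurable (liftGradient g d) (unif d) := by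
  have h1 : AEStronglyMeasurable (fun ζ : Sph d => g (scaledCoords n d ζ)) (unif d) :=
    hg.comp_quasiMeasurePreserving (quasiMeasurePreserving_scaledCoords hd)
  have h2 : AEStronglyMeasurable (fun ζ : Sph d => scaledCoords n d ζ) (unif d) :=
    (measurable_scaledCoords_sphere n d).aestronglyMeasurable
  have h3 : AEStronglyMeasurable
      (fun ζ : Sph d => (scaledCoords n d).adjoint (g (scaledCoords n d ζ))) (unif d) :=
    (scaledCoords n d).adjoint.continuous.comp_aestronglyMeasurable h1
  have h4 : AEStronglyMeasurable (fun ζ : Sph d =>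
      (inner ℝ (g (scaledCoords n d ζ)) (scaledCoords n d ζ) : ℝ)) (unif d) := h1.inner h2
  have h5 : AEStronglyMeasurable (fun ζ : Sph d => (ζ : Euc (d + 1))) (unif d) :=
    continuous_subtype_val.aestronglyMeasurable
  exact h3.sub (h4.smul h5)

theorem memLp_comp_scaledCoords {C : ℝ≥0∞} (hC : C ≠ ⊤)
    (hle : (unif d).map (fun ζ : Sph d => scaledCoords n d ζ) ≤ C • volume)
    {E : Type*} [NormedAddCommGroup E] {f : Euc n → E} {p : ℝ≥0∞}
    (hf : MemLp f p volume) : MemLp (fun ζ : Sph d => f (scaledCoords n d ζ)) p (unif d) :=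
  (hf.of_measure_le_smul hC hle).comp_of_map (measurable_scaledCoords_sphere n d).aemeasurable

theorem memLp_liftGradient {C : ℝ≥0∞} (hC : C ≠ ⊤)
    (hle : (unif d).map (fun ζ : Sph d => scaledCoords n d ζ) ≤ C • volume)
    (hd : 2 * (n + 1) ≤ d) {g : Euc n → Euc n} (hg : MemLp g 2 volume) :
    MemLp (liftGradient g d) 2 (unif d) := by
  refine (memLp_comp_scaledCoords hC hle hg).of_le_mul (c := √d)
    (aestronglyMeasurable_liftGradient hd hg.1) (Eventually.of_forall fun ζ => ?_)
  refine (sq_le_sq₀ (norm_nonneg _) (by positivity)).1 ?_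
  rw [norm_sq_liftGradient (by omega), mul_pow, Real.sq_sqrt (Nat.cast_nonneg d)]
  linarith [sq_nonneg (inner ℝ (g (scaledCoords n d ζ)) (scaledCoords n d ζ) : ℝ)]

/-- Serves to pass to the limit on both sides of the integration by parts at fixed d. Convergence in
L²(dx) gives convergence in L² and then L¹ of the sphere, and Y is bounded. -/
theorem tendsto_integral_inner_comp_scaledCoords {C : ℝ≥0∞} (hC : C ≠ ⊤)
    (hle : (unif d).map (fun ζ : Sph d => scaledCoords n d ζ) ≤ C • volume)
    {F : Type*} [NormedAddCommGroup F]
    [InnerProductSpace ℝ F] {f : ℕ → Euc n → F} {f₀ : Euc n → F} (hf : MemLp f₀ 2 volume)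
    (hfm : ∀ k, AEStronglyMeasurable (f k) volume)
    (hlim : Tendsto (fun k => eLpNorm (f k - f₀) 2 volume) atTop (𝓝 0))
    {Y : Sph d → F} (hY : Continuous Y) :
    Tendsto (fun k => ∫ ζ : Sph d, inner ℝ (f k (scaledCoords n d ζ)) (Y ζ) ∂(unif d)) atTop
      (𝓝 (∫ ζ : Sph d, inner ℝ (f₀ (scaledCoords n d ζ)) (Y ζ) ∂(unif d))) := by
  obtain ⟨M, hM⟩ := isCompact_univ.exists_bound_of_continuousOn hY.continuousOn
  have hint : ∀ {h : Euc n → F}, MemLp h 2 volume →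
      Integrable (fun ζ : Sph d => inner ℝ (h (scaledCoords n d ζ)) (Y ζ)) (unif d) := by
    intro h hh
    have h1 := memLp_comp_scaledCoords hC hle hh
    refine ((h1.integrable one_le_two).norm.mul_const M).mono'
      (h1.1.inner hY.aestronglyMeasurable) (Eventually.of_forall fun ζ => ?_)
    exact (norm_inner_le_norm _ _).trans
      (mul_le_mul_of_nonneg_left (hM ζ (Set.mem_univ _)) (norm_nonneg _))
  have hmem : ∀ᶠ k in atTop, MemLp (f k - f₀) 2 volume := by
    filter_upwards [hlim.eventually_lt_const ENNReal.zero_lt_top] with k hk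
    exact ⟨(hfm k).sub hf.1, hk⟩
  refine tendsto_integral_of_L1 _ (hint hf).1 ?_ ?_
  · filter_upwards [hmem] with k hk
    have := hk.add hf
    rw [sub_add_cancel] at this
    exact hint this
  · set K := C ^ (1 / (2 : ℝ≥0∞)).toReal
    have hK : K ≠ ⊤ := ENNReal.rpow_ne_top_of_nonneg ENNReal.toReal_nonneg hC
    have h0 : Tendsto (fun k => K * eLpNorm (f k - f₀) 2 volume * ENNReal.ofReal M) atTop
        (𝓝 0) := by
      have := ENNReal.Tendsto.mul_const (b := ENNReal.ofReal M)
        (ENNReal.Tendsto.const_mul hlim (Or.inr hK)) (Or.inr ENNReal.ofReal_ne_top)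
      simpa using this
    refine tendsto_of_tendsto_of_tendsto_of_le_of_le' tendsto_const_nhds h0
      (Eventually.of_forall fun k => zero_le) ?_
    filter_upwards [hmem] with k hk
    have hT := measurable_scaledCoords_sphere n d
    have hm := (hk.of_measure_le_smul hC hle).1
    calc ∫⁻ ζ : Sph d, ‖inner ℝ (f k (scaledCoords n d ζ)) (Y ζ) -
          inner ℝ (f₀ (scaledCoords n d ζ)) (Y ζ)‖ₑ ∂(unif d)
        ≤ ∫⁻ ζ : Sph d, ‖(f k - f₀) (scaledCoords n d ζ)‖ₑ * ENNReal.ofReal M ∂(unif d) := by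
          refine lintegral_mono fun ζ => ?_
          simp only
          rw [← inner_sub_left, ← ofReal_norm, ← ofReal_norm,
            ← ENNReal.ofReal_mul (norm_nonneg _)]
          exact ENNReal.ofReal_le_ofReal ((norm_inner_le_norm _ _).trans
            (mul_le_mul_of_nonneg_left (hM ζ (Set.mem_univ _)) (norm_nonneg _)))
      _ = eLpNorm (fun ζ : Sph d => (f k - f₀) (scaledCoords n d ζ)) 1 (unif d) *
            ENNReal.ofReal M := by
          rw [lintegral_mul_const' _ _ ENNReal.ofReal_ne_top, eLpNorm_one_eq_lintegral_enorm]
      _ ≤ eLpNorm (fun ζ : Sph d => (f k - f₀) (scaledCoords n d ζ)) 2 (unif d) *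
            ENNReal.ofReal M := by
          gcongr
          exact eLpNorm_le_eLpNorm_of_exponent_le one_le_two
            (memLp_comp_scaledCoords hC hle hk).1
      _ ≤ K * eLpNorm (f k - f₀) 2 volume * ENNReal.ofReal M := by
          gcongr
          have h1 := eLpNorm_map_measure (p := 2) hm hT.aemeasurable
          refine le_of_eq_of_le h1.symm ((eLpNorm_mono_measure _ hle).trans_eq ?_)
          rw [eLpNorm_smul_measure_of_ne_top ENNReal.ofNat_ne_top]
          rfl

/-- For mollifications of v this is the chain rule and integration by parts on the sphere; both
sides are continuous under the L² convergence of functions and gradients. -/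
theorem isSphereWeakGradient_liftGradient {C : ℝ≥0∞} (hC : C ≠ ⊤)
    (hle : (unif d).map (fun ζ : Sph d => scaledCoords n d ζ) ≤ C • volume)
    {v : Euc n → ℝ} {g : Euc n → Euc n}
    (hv : MemLp v 2 volume) (hg : MemLp g 2 volume) (hw : IsWeakGradient v g) {R : ℝ}
    (hR : ∀ᵐ x, x ∉ Metric.closedBall (0 : Euc n) R → v x = 0) :
    IsSphereWeakGradient (liftToSphere v d) (liftGradient g d) := by
  refine ⟨Eventually.of_forall fun ζ => inner_liftGradient_self g ζ, fun X hX hXt => ?_⟩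
  obtain ⟨φ, hφ, -, hφv, hφg⟩ := exists_smooth_approx hv hg hw hR
  have hXc : Continuous fun ζ : Sph d => X ζ := hX.continuous.comp continuous_subtype_val
  have hgm : ∀ k, AEStronglyMeasurable (gradient (φ k)) volume := fun k =>
    (((InnerProductSpace.toDual ℝ (Euc n)).symm.continuous.comp
      ((hφ k).continuous_fderiv (by simp)))).aestronglyMeasurable
  have h1 := tendsto_integral_inner_comp_scaledCoords hC hle hg hgm hφg
    ((scaledCoords n d).continuous.comp hXc)
  have h2 := (tendsto_integral_inner_comp_scaledCoords hC hle hv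
    (fun k => (hφ k).continuous.aestronglyMeasurable) hφv (continuous_sphereDiv hX)).neg
  have h3 : ∀ k, ∫ ζ : Sph d, inner ℝ (gradient (φ k) (scaledCoords n d ζ))
      (scaledCoords n d (X ζ)) ∂(unif d) =
      -∫ ζ : Sph d, inner ℝ (φ k (scaledCoords n d ζ)) (sphereDiv X ζ) ∂(unif d) := by
    intro k
    have h4 := integral_fderiv_sphere hX hXt ((hφ k).comp (scaledCoords n d).contDiff)
    refine Eq.trans (integral_congr_ae (Eventually.of_forall fun ζ => ?_))
      (h4.trans (congrArg _ (integral_congr_ae (Eventually.of_forall fun ζ => ?_))))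
    · simp only
      have h5 := ((hφ k).differentiable (by simp) (scaledCoords n d ζ)).hasFDerivAt.comp
        (ζ : Euc (d + 1)) (scaledCoords n d).hasFDerivAt
      rw [h5.fderiv, gradient, InnerProductSpace.toDual_symm_apply]
      rfl
    · simp [mul_comm]
  have h6 := tendsto_nhds_unique (h1.congr h3) h2
  refine Eq.trans (integral_congr_ae (Eventually.of_forall fun ζ => ?_))
    (h6.trans (congrArg _ (integral_congr_ae (Eventually.of_forall fun ζ => ?_))))
  · exact inner_liftGradient g ζ (hXt ζ)
  · simp [liftToSphere_eq, mul_comm]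

end

theorem eventually_memSphereH1 {n : ℕ} {v : Euc n → ℝ} (hv : MemH1 v) {R : ℝ}
    (hR : ∀ᵐ x, x ∉ Metric.closedBall (0 : Euc n) R → v x = 0) :
    ∀ᶠ d in atTop, MemSphereH1 (liftToSphere v d) ∧
      sphereWeakGradient (liftToSphere v d) =ᵐ[unif d] liftGradient (weakGradient v) d := by
  obtain ⟨C, hC, hle⟩ := exists_map_scaledCoords_le n
  obtain ⟨hg, hw⟩ := weakGradient_spec hv
  filter_upwards [hle, eventually_ge_atTop (2 * (n + 1))] with d hle hd
  have h1 := memLp_liftGradient hC hle hd hg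
  have h2 := isSphereWeakGradient_liftGradient hC hle hv.1 hg hw hR
  exact ⟨⟨memLp_comp_scaledCoords hC hle hv.1, _, h1, h2⟩, sphereWeakGradient_spec h1 h2⟩

/-- Convergence of the Dirichlet energies. -/
theorem tendsto_lpNorm_sphereWeakGradient {n : ℕ} {v : Euc n → ℝ} (hv : MemH1 v) {R : ℝ}
    (hR : ∀ᵐ x, x ∉ Metric.closedBall (0 : Euc n) R → v x = 0) :
    Tendsto (fun d : ℕ => 1 / (d : ℝ) *
        lpNorm (sphereWeakGradient (liftToSphere v d)) 2 (unif d) ^ 2) atTop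
      (𝓝 (lpNorm (weakGradient v) 2 (gauss n) ^ 2)) := by
  obtain ⟨hg, hw⟩ := weakGradient_spec hv
  set g := weakGradient v with hgdef
  have hg0 := hw.ae_eq_zero_of_notMem hv.1 hg hR
  have hmg : AEStronglyMeasurable g (gauss n) := (memLp_gauss hg).1
  rw [lpNorm_two_sq hmg]
  -- The integrand is |`liftGradient`|²/d as a function of y. The majorant comes from
  -- Cauchy–Schwarz, as g vanishes almost everywhere outside the ball of radius R + 1.
  have hlim := tendsto_integral_unif
    (f := fun (d : ℕ) y => ‖g y‖ ^ 2 - (inner ℝ (g y) y) ^ 2 * (d : ℝ)⁻¹) (g := fun y => ‖g y‖ ^ 2)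
    (F := fun y => ‖g y‖ ^ 2 * (1 + (R + 1) ^ 2)) ?_ ?_ ?_ ?_
  · refine hlim.congr' ?_
    filter_upwards [eventually_memSphereH1 hv hR, eventually_ge_atTop (2 * (n + 1))] with d hd hd2
    have hd0 : (d : ℝ) ≠ 0 := by
      have : d ≠ 0 := by omega
      exact_mod_cast this
    have hm := aestronglyMeasurable_liftGradient hd2 hg.1
    rw [lpNorm_two_sq (hm.congr hd.2.symm), ← integral_const_mul]
    refine integral_congr_ae ?_
    filter_upwards [hd.2] with ζ hζ
    rw [hζ, ← hgdef, norm_sq_liftGradient (by omega)]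
    field_simp
  · refine Eventually.of_forall fun d => ?_
    have h1 : AEStronglyMeasurable (fun y => (inner ℝ (g y) y : ℝ)) volume :=
      hg.1.inner aestronglyMeasurable_id
    exact (hg.1.norm.pow 2).sub ((h1.pow 2).mul_const _)
  · exact (hg.integrable_norm_pow two_ne_zero).mul_const _
  · filter_upwards [eventually_ge_atTop 1] with d hd
    have hd1 : (1 : ℝ) ≤ d := by exact_mod_cast hd
    filter_upwards [hg0] with y hy
    rw [← div_eq_mul_inv]
    by_cases hyR : y ∈ Metric.closedBall (0 : Euc n) (R + 1)
    · have h1 : ‖y‖ ≤ R + 1 := by simpa using hyR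
      have h2 : (inner ℝ (g y) y : ℝ) ^ 2 ≤ ‖g y‖ ^ 2 * (R + 1) ^ 2 := by
        rw [← mul_pow, ← sq_abs]
        exact pow_le_pow_left₀ (abs_nonneg _) ((abs_real_inner_le_norm _ _).trans
          (mul_le_mul_of_nonneg_left h1 (norm_nonneg _))) 2
      have h3 : (inner ℝ (g y) y : ℝ) ^ 2 / d ≤ (inner ℝ (g y) y : ℝ) ^ 2 :=
        div_le_self (sq_nonneg _) hd1
      have h4 : 0 ≤ (inner ℝ (g y) y : ℝ) ^ 2 / d := by positivity
      have h5 : 0 ≤ ‖g y‖ ^ 2 := by positivity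
      have h6 : 0 ≤ ‖g y‖ ^ 2 * (R + 1) ^ 2 := by positivity
      rw [abs_le]
      constructor <;> nlinarith
    · simp [hy hyR]
  · refine Eventually.of_forall fun y => ?_
    have := (tendsto_natCast_atTop_atTop (R := ℝ)).const_div_atTop ((inner ℝ (g y) y : ℝ) ^ 2)
    simpa [div_eq_mul_inv] using this.const_sub (‖g y‖ ^ 2)

/-! ### Linearization at p = 2 and uniform bounds -/

/-- The power function `x ^ (2 / p)` is linearized near `p = 2`. -/
theorem tendsto_sub_rpow_div {m B : ℝ} (hm : 0 < m) {M b p : ℕ → ℝ}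
    (hM : Tendsto M atTop (𝓝 m)) (hb : Tendsto b atTop (𝓝 B)) (hp : Tendsto p atTop (𝓝 2))
    (hp2 : ∀ᶠ d in atTop, p d ≠ 2) :
    Tendsto (fun d => (M d - (M d + (p d - 2) * b d) ^ (2 / p d)) / (2 - p d)) atTop
      (𝓝 (B - 1 / 2 * (m * Real.log m))) := by
  -- Strict differentiability is required because both points compared, (M + (p - 2) b, p) and (M,
  -- 2), vary with d. Their difference is O(p - 2), so the remainder is o(p - 2).
  have hf : HasStrictFDerivAt (fun x : ℝ × ℝ => x.1 ^ (2 / x.2))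
      (ContinuousLinearMap.fst ℝ ℝ ℝ - (1 / 2 * (m * Real.log m)) •
        ContinuousLinearMap.snd ℝ ℝ ℝ) (m, 2) := by
    have h1 : HasStrictFDerivAt (fun x : ℝ × ℝ => x.1) (ContinuousLinearMap.fst ℝ ℝ ℝ) (m, 2) :=
      hasStrictFDerivAt_fst
    have h2 : HasStrictDerivAt (fun t : ℝ => 2 / t) (-(1 / 2)) 2 := by
      have := (hasStrictDerivAt_inv (two_ne_zero (α := ℝ))).const_mul 2
      simp only [← div_eq_mul_inv] at this
      exact this.congr_deriv (by norm_num)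
    have h3 : HasStrictFDerivAt (fun x : ℝ × ℝ => 2 / x.2)
        ((-(1 / 2) : ℝ) • ContinuousLinearMap.snd ℝ ℝ ℝ) (m, 2) :=
      HasStrictDerivAt.comp_hasStrictFDerivAt (h₂ := fun t : ℝ => 2 / t) (m, 2) h2
        hasStrictFDerivAt_snd
    refine (h1.rpow h3 hm).congr_fderiv ?_
    ext <;> simp
    ring
  have hlim1 : Tendsto (fun d => (p d - 2) * b d) atTop (𝓝 0) := by
    simpa using (hp.sub_const 2).mul hb
  have hlim : Tendsto (fun d => ((M d + (p d - 2) * b d, p d), (M d, (2 : ℝ)))) atTop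
      (𝓝 ((m, 2), (m, 2))) := by
    have : Tendsto (fun d => M d + (p d - 2) * b d) atTop (𝓝 m) := by
      simpa using hM.add hlim1
    exact (this.prodMk_nhds hp).prodMk_nhds (hM.prodMk_nhds tendsto_const_nhds)
  have ho := hf.isLittleO.comp_tendsto hlim
  have hO : (fun d => ((M d + (p d - 2) * b d, p d) : ℝ × ℝ) - (M d, 2)) =O[atTop]
      fun d => p d - 2 := by
    have hb1 : b =O[atTop] fun _ => (1 : ℝ) := hb.isBigO_one ℝ
    have h1 : (fun d => (p d - 2) * b d) =O[atTop] fun d => (p d - 2) * 1 :=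
      (Asymptotics.isBigO_refl _ _).mul hb1
    have h2 := h1.prod_left ((Asymptotics.isBigO_refl (fun d => p d - 2) atTop).congr_right
      fun d => (mul_one _).symm)
    simpa using h2
  have hdiv := (ho.trans_isBigO hO).tendsto_div_nhds_zero
  have hfin := (hdiv.add (hb.sub_const (1 / 2 * (m * Real.log m))))
  rw [zero_add] at hfin
  refine hfin.congr' ?_
  filter_upwards [hp2] with d hd
  have h1 : p d - 2 ≠ 0 := sub_ne_zero.2 hd
  have h2 : 2 - p d ≠ 0 := sub_ne_zero.2 hd.symm
  simp only [Function.comp_apply, Prod.mk_sub_mk, sub_apply,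
    ContinuousLinearMap.coe_fst', smul_apply, ContinuousLinearMap.coe_snd',
    smul_eq_mul, div_self (two_ne_zero (α := ℝ)), Real.rpow_one]
  have h3 : 2 - p d = -(p d - 2) := by ring
  rw [h3]
  field_simp
  ring

/-- For t ≤ 1 the factor t absorbs the logarithm; for t > 1 one uses log t ≤ t^δ/δ. The bound does
not depend on p and will dominate the difference quotients. -/
theorem abs_log_mul_max_le {δ p t : ℝ} (hδ : 0 < δ) (hp1 : 1 ≤ p) (hp2 : p ≤ 2 + δ)
    (ht : 0 ≤ t) :
    |Real.log t| * max (t ^ 2) (t ^ p) ≤ (1 + δ⁻¹) * (1 + t ^ (2 + 2 * δ)) := by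
  have hpow : 0 ≤ t ^ (2 + 2 * δ) := Real.rpow_nonneg ht _
  have hδ' : 0 < δ⁻¹ := inv_pos.2 hδ
  rcases ht.eq_or_lt with rfl | ht0
  · rw [Real.log_zero, abs_zero, zero_mul]
    positivity
  rcases le_or_gt t 1 with ht1 | ht1
  · have h1 : max (t ^ 2) (t ^ p) ≤ t := by
      refine max_le (by nlinarith) ?_
      simpa using Real.rpow_le_rpow_of_exponent_ge ht0 ht1 hp1
    have h2 := (Real.abs_log_mul_self_lt t ht0 ht1).le
    rw [abs_mul, abs_of_pos ht0] at h2
    calc _ ≤ |Real.log t| * t := mul_le_mul_of_nonneg_left h1 (abs_nonneg _)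
      _ ≤ 1 := h2
      _ ≤ _ := by nlinarith
  · have h1 : max (t ^ 2) (t ^ p) ≤ t ^ (2 + δ) := by
      refine max_le ?_ (Real.rpow_le_rpow_of_exponent_le ht1.le hp2)
      rw [← Real.rpow_ofNat]
      exact Real.rpow_le_rpow_of_exponent_le ht1.le (by linarith)
    have h2 : |Real.log t| ≤ t ^ δ / δ := by
      rw [abs_of_nonneg (Real.log_nonneg ht1.le)]
      exact Real.log_le_rpow_div ht hδ
    calc _ ≤ t ^ δ / δ * t ^ (2 + δ) :=
          mul_le_mul h2 h1 (le_max_of_le_left (sq_nonneg t)) (by positivity)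
      _ = δ⁻¹ * t ^ (2 + 2 * δ) := by
          rw [div_mul_eq_mul_div, ← Real.rpow_add ht0]
          ring_nf
      _ ≤ _ := by nlinarith

/-- Write t^p = t² e^a with a = (p - 2) log t and use |e^a - 1| ≤ |a| max(1, e^a), which reduces the
claim to the previous bound. -/
theorem abs_rpow_sub_sq_div_le {δ p t : ℝ} (hδ : 0 < δ) (hp1 : 1 ≤ p) (hp2 : p ≤ 2 + δ)
    (ht : 0 ≤ t) (hp : p ≠ 2) :
    |(t ^ p - t ^ 2) / (p - 2)| ≤ (1 + δ⁻¹) * (1 + t ^ (2 + 2 * δ)) := by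
  refine le_trans ?_ (abs_log_mul_max_le hδ hp1 hp2 ht)
  have hp0 : 0 < |p - 2| := abs_pos.2 (sub_ne_zero.2 hp)
  rw [abs_div, div_le_iff₀ hp0]
  rcases ht.eq_or_lt with rfl | ht0
  · simp [Real.zero_rpow (by linarith : p ≠ 0)]
  set a := (p - 2) * Real.log t with ha
  have h1 : t ^ p = t ^ 2 * Real.exp a := by
    rw [ha, mul_comm (p - 2), ← Real.rpow_def_of_pos ht0, ← Real.rpow_ofNat, ← Real.rpow_add ht0]
    ring_nf
  have ht2 : 0 < t ^ 2 := by positivity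
  have h2 : |Real.exp a - 1| ≤ |a| * max 1 (Real.exp a) := by
    rcases le_total 0 a with h | h
    · have h3 := Real.one_sub_le_exp_neg a
      have h4 : Real.exp a * Real.exp (-a) = 1 := by rw [← Real.exp_add]; simp
      have h5 := Real.exp_pos a
      have h6 : 1 ≤ Real.exp a := Real.one_le_exp h
      rw [abs_of_nonneg (by linarith), abs_of_nonneg h, max_eq_right h6]
      nlinarith
    · have h3 := Real.add_one_le_exp a
      have h6 : Real.exp a ≤ 1 := Real.exp_le_one_iff.2 h
      rw [abs_of_nonpos (by linarith), abs_of_nonpos h, max_eq_left h6]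
      linarith
  calc |t ^ p - t ^ 2| = t ^ 2 * |Real.exp a - 1| := by
        rw [h1, ← mul_sub_one, abs_mul, abs_of_pos ht2]
    _ ≤ t ^ 2 * (|a| * max 1 (Real.exp a)) := by gcongr
    _ = |Real.log t| * max (t ^ 2) (t ^ p) * |p - 2| := by
        rw [h1, ha, abs_mul]
        nth_rewrite 2 [← mul_one (t ^ 2)]
        rw [← mul_max_of_nonneg _ _ ht2.le]
        ring

theorem tendsto_rpow_sub_sq_div {t : ℝ} (ht : 0 ≤ t) {p : ℕ → ℝ} (hp : Tendsto p atTop (𝓝 2))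
    (hp2 : ∀ᶠ d in atTop, p d ≠ 2) :
    Tendsto (fun d => (t ^ p d - t ^ 2) / (p d - 2)) atTop (𝓝 (t ^ 2 * Real.log t)) := by
  rcases ht.eq_or_lt with rfl | ht0
  · simp only [Real.log_zero, mul_zero]
    refine tendsto_const_nhds.congr' ?_
    filter_upwards [hp.eventually_ne two_ne_zero] with d hd
    simp [Real.zero_rpow hd]
  · have h1 : HasDerivAt (fun x : ℝ => t ^ x) (t ^ (2 : ℝ) * Real.log t) 2 :=
      (Real.hasStrictDerivAt_const_rpow ht0 2).hasDerivAt
    have h2 := (hasDerivAt_iff_tendsto_slope.1 h1).comp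
      (tendsto_nhdsWithin_iff.2 ⟨hp, hp2⟩)
    simp only [Real.rpow_ofNat] at h2
    refine h2.congr fun d => ?_
    simp [slope_def_field]

/-- Expanding the logarithm separates the integral of |f|² log |f|, which has an integrand
independent of the measure, from a continuous function of the norm. If the norm is 0, then f = 0
almost everywhere and all terms vanish. -/
theorem entropy_eq {α : Type*} [MeasurableSpace α] {μ : Measure α} {f : α → ℝ}
    (hf : MemLp f 2 μ) (hlog : Integrable (fun x => |f x| ^ 2 * Real.log |f x|) μ) :
    Integrable (entropyDensity μ f) μ ∧ ∫ x, entropyDensity μ f x ∂μ =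
      2 * ∫ x, |f x| ^ 2 * Real.log |f x| ∂μ -
        lpNorm f 2 μ ^ 2 * Real.log (lpNorm f 2 μ ^ 2) := by
  have hint : Integrable (fun x => |f x| ^ 2) μ := hf.integrable_norm_pow two_ne_zero
  have hm : lpNorm f 2 μ ^ 2 = ∫ x, |f x| ^ 2 ∂μ := lpNorm_two_sq hf.1
  set m := lpNorm f 2 μ ^ 2 with hmdef
  have hae : entropyDensity μ f =ᵐ[μ]
      fun x => 2 * (|f x| ^ 2 * Real.log |f x|) - |f x| ^ 2 * Real.log m := by
    by_cases h0 : lpNorm f 2 μ = 0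
    · have hz := (lpNorm_eq_zero hf two_ne_zero).1 h0
      filter_upwards [hz] with x hx
      simp [entropyDensity, hx]
    · have hm0 : m ≠ 0 := pow_ne_zero 2 h0
      refine Eventually.of_forall fun x => ?_
      by_cases hx : f x = 0
      · simp [entropyDensity, hx]
      · have hx2 : |f x| ^ 2 ≠ 0 := pow_ne_zero 2 (abs_ne_zero.2 hx)
        rw [entropyDensity, Real.log_div hx2 hm0, Real.log_pow]
        push_cast
        ring
  refine ⟨((hlog.const_mul 2).sub (hint.mul_const _)).congr hae.symm, ?_⟩
  rw [integral_congr_ae hae, integral_sub (hlog.const_mul 2) (hint.mul_const _),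
    integral_const_mul, integral_mul_const, ← hm]

/-! ### Limits of norms and entropies -/

section Limits

variable {n : ℕ} {v : Euc n → ℝ} {R q : ℝ}

theorem integrable_majorant (hq : 2 < q) (hvq : MemLp v (ENNReal.ofReal q) volume) (R C : ℝ) :
    Integrable ((Metric.closedBall (0 : Euc n) R).indicator fun y => C * (1 + |v y| ^ q))
      volume := by
  have hq0 : 0 < q := by linarith
  have h1 : Integrable (fun y => |v y| ^ q) volume := by
    have := hvq.integrable_norm_rpow (by simpa using hq0) ENNReal.ofReal_ne_top
    rwa [ENNReal.toReal_ofReal hq0.le] at this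
  rw [integrable_indicator_iff measurableSet_closedBall]
  refine Integrable.const_mul (Integrable.add ?_ h1.integrableOn) C
  exact integrableOn_const (measure_closedBall_lt_top (x := (0 : Euc n)) (r := R)).ne

/-- Outside the ball v vanishes, so h(0) = 0 allows the majorant to be cut off there; otherwise the
constant 1 would not be integrable. -/
theorem le_majorant (hR : ∀ᵐ x, x ∉ Metric.closedBall (0 : Euc n) R → v x = 0) {C : ℝ}
    {h : ℝ → ℝ} (h0 : h 0 = 0) (hC : ∀ t, 0 ≤ t → |h t| ≤ C * (1 + t ^ q)) :
    ∀ᵐ y, |h (|v y|)| ≤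
      (Metric.closedBall (0 : Euc n) R).indicator (fun y => C * (1 + |v y| ^ q)) y := by
  filter_upwards [hR] with y hy
  by_cases hyR : y ∈ Metric.closedBall (0 : Euc n) R
  · rw [Set.indicator_of_mem hyR]
    exact hC _ (abs_nonneg _)
  · rw [Set.indicator_of_notMem hyR, hy hyR, abs_zero, h0, abs_zero]

theorem abs_sq_mul_log_le (hq : 2 < q) {t : ℝ} (ht : 0 ≤ t) :
    |t ^ 2 * Real.log t| ≤ (1 + ((q - 2) / 2)⁻¹) * (1 + t ^ q) := by
  have h := abs_log_mul_max_le (δ := (q - 2) / 2) (p := 2) (by linarith) (by norm_num)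
    (by linarith) ht
  rw [show 2 + 2 * ((q - 2) / 2) = q by ring] at h
  refine le_trans ?_ h
  rw [abs_mul, mul_comm, abs_of_nonneg (sq_nonneg t)]
  exact mul_le_mul_of_nonneg_left (le_max_left _ _) (abs_nonneg _)

theorem integrable_sq_mul_log (hv : MemLp v 2 volume) (hq : 2 < q)
    (hvq : MemLp v (ENNReal.ofReal q) volume)
    (hR : ∀ᵐ x, x ∉ Metric.closedBall (0 : Euc n) R → v x = 0) :
    Integrable (fun y => |v y| ^ 2 * Real.log |v y|) volume := by
  refine (integrable_majorant hq hvq R _).mono' ?_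
    (le_majorant hR (h := fun t => t ^ 2 * Real.log t) (by simp)
      fun t ht => abs_sq_mul_log_le hq ht)
  have h1 : AEStronglyMeasurable (fun y => |v y|) volume := hv.1.norm
  exact (h1.pow 2).mul (Real.measurable_log.comp_aemeasurable h1.aemeasurable).aestronglyMeasurable

theorem tendsto_lpNorm_liftToSphere (hv : MemLp v 2 volume) :
    Tendsto (fun d => lpNorm (liftToSphere v d) 2 (unif d) ^ 2) atTop
      (𝓝 (lpNorm v 2 (gauss n) ^ 2)) := by
  obtain ⟨C, hC, hle⟩ := exists_map_scaledCoords_le n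
  rw [lpNorm_two_sq (memLp_gauss hv).1]
  have hint : Integrable (fun y => ‖v y‖ ^ 2) volume := hv.integrable_norm_pow two_ne_zero
  refine (tendsto_integral_unif (f := fun _ y => ‖v y‖ ^ 2) (F := fun y => ‖v y‖ ^ 2)
    (Eventually.of_forall fun _ => hint.1) hint
    (Eventually.of_forall fun _ => Eventually.of_forall fun y => by simp)
    (Eventually.of_forall fun y => tendsto_const_nhds)).congr' ?_
  filter_upwards [hle] with d hd
  have hv2 : MemLp (liftToSphere v d) 2 (unif d) := memLp_comp_scaledCoords hC hd hv
  rw [lpNorm_two_sq hv2.1]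
  rfl

theorem eventually_integrable_sq_mul_log (hv : MemLp v 2 volume) (hq : 2 < q)
    (hvq : MemLp v (ENNReal.ofReal q) volume)
    (hR : ∀ᵐ x, x ∉ Metric.closedBall (0 : Euc n) R → v x = 0) :
    ∀ᶠ d in atTop, Integrable
      (fun ζ : Sph d => |liftToSphere v d ζ| ^ 2 * Real.log |liftToSphere v d ζ|) (unif d) := by
  obtain ⟨C, hC, hle⟩ := exists_map_scaledCoords_le n
  filter_upwards [hle] with d hd
  have h1 := memLp_one_iff_integrable.2 (integrable_sq_mul_log hv hq hvq hR)
  exact memLp_one_iff_integrable.1 (memLp_comp_scaledCoords hC hd h1)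

theorem tendsto_entropy (hv : MemLp v 2 volume) (hq : 2 < q)
    (hvq : MemLp v (ENNReal.ofReal q) volume)
    (hR : ∀ᵐ x, x ∉ Metric.closedBall (0 : Euc n) R → v x = 0) :
    Tendsto (fun d => ∫ ζ, entropyDensity (unif d) (liftToSphere v d) ζ ∂(unif d)) atTop
      (𝓝 (∫ y, entropyDensity (gauss n) v y ∂(gauss n))) := by
  obtain ⟨C, hC, hle⟩ := exists_map_scaledCoords_le n
  have hlog := integrable_sq_mul_log hv hq hvq hR
  have hlogG : Integrable (fun y => |v y| ^ 2 * Real.log |v y|) (gauss n) :=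
    memLp_one_iff_integrable.1 (memLp_gauss (memLp_one_iff_integrable.2 hlog))
  rw [(entropy_eq (memLp_gauss hv) hlogG).2]
  have h1 := tendsto_integral_unif (f := fun _ y => |v y| ^ 2 * Real.log |v y|)
    (Eventually.of_forall fun _ => hlog.1) hlog.abs
    (Eventually.of_forall fun _ => Eventually.of_forall fun y => le_rfl)
    (Eventually.of_forall fun y => tendsto_const_nhds)
  have h2 := (Real.continuous_mul_log.tendsto _).comp (tendsto_lpNorm_liftToSphere hv)
  refine ((h1.const_mul 2).sub h2).congr' ?_
  filter_upwards [hle, eventually_integrable_sq_mul_log hv hq hvq hR] with d hd hd2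
  have hv2 : MemLp (liftToSphere v d) 2 (unif d) := memLp_comp_scaledCoords hC hd hv
  rw [(entropy_eq hv2 hd2).2]
  rfl

/-- The difference quotients of the norms converge to the entropy. -/
theorem tendsto_lpNorm_sub_div (hv : MemLp v 2 volume) (hq : 2 < q)
    (hvq : MemLp v (ENNReal.ofReal q) volume)
    (hR : ∀ᵐ x, x ∉ Metric.closedBall (0 : Euc n) R → v x = 0) {p : ℕ → ℝ}
    (hp : Tendsto p atTop (𝓝 2)) (hp2 : ∀ᶠ d in atTop, p d ≠ 2) :
    (∀ᶠ d in atTop, MemLp (liftToSphere v d) (ENNReal.ofReal (p d)) (unif d)) ∧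
    Tendsto (fun d => (lpNorm (liftToSphere v d) 2 (unif d) ^ 2 -
        lpNorm (liftToSphere v d) (ENNReal.ofReal (p d)) (unif d) ^ 2) / (2 - p d)) atTop
      (𝓝 (1 / 2 * ∫ y, entropyDensity (gauss n) v y ∂(gauss n))) := by
  obtain ⟨C, hC, hle⟩ := exists_map_scaledCoords_le n
  set δ := (q - 2) / 2 with hδdef
  have hδ : 0 < δ := by rw [hδdef]; linarith
  have hqδ : 2 + 2 * δ = q := by rw [hδdef]; ring
  have hp1 : ∀ᶠ d in atTop, 1 < p d := hp.eventually_const_lt one_lt_two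
  have hpδ : ∀ᶠ d in atTop, p d < 2 + δ := hp.eventually_lt_const (by linarith)
  have hmem : ∀ᶠ d in atTop, MemLp (liftToSphere v d) (ENNReal.ofReal (p d)) (unif d) := by
    filter_upwards [hle, hpδ] with d hd hd2
    exact (memLp_comp_scaledCoords hC hd hvq).mono_exponent
      (ENNReal.ofReal_le_ofReal (by linarith))
  refine ⟨hmem, ?_⟩
  have hlog := integrable_sq_mul_log hv hq hvq hR
  have hlogG : Integrable (fun y => |v y| ^ 2 * Real.log |v y|) (gauss n) :=
    memLp_one_iff_integrable.1 (memLp_gauss (memLp_one_iff_integrable.2 hlog))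
  rw [(entropy_eq (memLp_gauss hv) hlogG).2]
  have habs : AEStronglyMeasurable (fun y => |v y|) volume := hv.1.norm
  -- By definition ∫ |u|^p = ‖u‖₂² + (p - 2) b, and the integrand of `b` converges to |v|² log |v|,
  -- the derivative of |v|^p at p = 2.
  set b : ℕ → ℝ := fun d => ∫ ζ : Sph d,
    (|liftToSphere v d ζ| ^ p d - |liftToSphere v d ζ| ^ 2) / (p d - 2) ∂(unif d) with hbdef
  have hb : Tendsto b atTop (𝓝 (∫ y, |v y| ^ 2 * Real.log |v y| ∂(gauss n))) := by
    refine tendsto_integral_unif (f := fun d y => (|v y| ^ p d - |v y| ^ 2) / (p d - 2)) ?_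
      (integrable_majorant hq hvq R (1 + δ⁻¹)) ?_ ?_
    · refine Eventually.of_forall fun d => AEMeasurable.aestronglyMeasurable ?_
      exact ((habs.aemeasurable.pow_const _).sub (habs.aemeasurable.pow_const _)).div_const _
    · filter_upwards [hp1, hpδ, hp2] with d h1 h2 h3
      refine le_majorant hR (h := fun t => (t ^ p d - t ^ 2) / (p d - 2)) ?_ fun t ht => ?_
      · simp [Real.zero_rpow (by linarith : p d ≠ 0)]
      · rw [← hqδ]
        exact abs_rpow_sub_sq_div_le hδ h1.le h2.le ht h3
    · exact Eventually.of_forall fun y => tendsto_rpow_sub_sq_div (abs_nonneg _) hp hp2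
  have hM := tendsto_lpNorm_liftToSphere hv
  have hpow : ∀ᶠ d in atTop, lpNorm (liftToSphere v d) (ENNReal.ofReal (p d)) (unif d) ^ 2 =
      (lpNorm (liftToSphere v d) 2 (unif d) ^ 2 + (p d - 2) * b d) ^ (2 / p d) := by
    filter_upwards [hle, hmem, hp1, hp2] with d hd hd2 h1 h2
    have hp0 : 0 < p d := by linarith
    have hv2 : MemLp (liftToSphere v d) 2 (unif d) := memLp_comp_scaledCoords hC hd hv
    have hi1 : Integrable (fun ζ => |liftToSphere v d ζ| ^ p d) (unif d) := by
      have := hd2.integrable_norm_rpow (by simpa using hp0) ENNReal.ofReal_ne_top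
      rwa [ENNReal.toReal_ofReal hp0.le] at this
    have hi2 : Integrable (fun ζ => |liftToSphere v d ζ| ^ 2) (unif d) :=
      MemLp.integrable_norm_pow hv2 two_ne_zero
    have hsum : lpNorm (liftToSphere v d) 2 (unif d) ^ 2 + (p d - 2) * b d =
        ∫ ζ, |liftToSphere v d ζ| ^ p d ∂(unif d) := by
      rw [lpNorm_two_sq hv2.1, hbdef]
      simp only
      rw [integral_div, mul_div_cancel₀ _ (sub_ne_zero.2 h2), integral_sub hi1 hi2]
      exact add_sub_cancel _ _
    rw [hsum, lpNorm_eq_integral_norm_rpow_toReal (by simpa using hp0) ENNReal.ofReal_ne_top hd2.1,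
      ENNReal.toReal_ofReal hp0.le, ← Real.rpow_natCast, ← Real.rpow_mul
        (integral_nonneg fun _ => by positivity)]
    congr 1
    push_cast
    ring
  -- The linearization requires a positive base point ‖v‖². If the norm is 0, then v = 0 almost
  -- everywhere and both sides are eventually 0.
  rcases (lpNorm_nonneg (f := v) (p := 2) (μ := gauss n)).eq_or_lt with h0 | h0
  · have hz : v =ᵐ[gauss n] 0 := (lpNorm_eq_zero (memLp_gauss hv) two_ne_zero).1 h0.symm
    have hz' : v =ᵐ[volume] 0 := (absolutelyContinuous_gauss n).ae_eq hz
    have hI : ∫ y, |v y| ^ 2 * Real.log |v y| ∂(gauss n) = 0 := by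
      refine integral_eq_zero_of_ae ?_
      filter_upwards [hz] with y hy
      simp [hy]
    rw [hI, ← h0]
    simp only [ne_eq, OfNat.ofNat_ne_zero, not_false_eq_true, zero_pow, mul_zero, zero_mul,
      sub_zero]
    refine tendsto_const_nhds.congr' ?_
    filter_upwards [hmem, hle, hp1, eventually_ge_atTop (2 * (n + 1))] with d hd hd1 h1 hd2
    have hu : liftToSphere v d =ᵐ[unif d] 0 :=
      (quasiMeasurePreserving_scaledCoords hd2).ae_eq_comp hz'
    have hp0 : 0 < p d := by linarith
    have hv2 : MemLp (liftToSphere v d) 2 (unif d) := memLp_comp_scaledCoords hC hd1 hv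
    rw [(lpNorm_eq_zero hd (by simpa using hp0)).2 hu,
      (lpNorm_eq_zero hv2 two_ne_zero).2 hu]
    simp
  · have hlim := tendsto_sub_rpow_div (pow_pos h0 2) hM hb hp hp2
    rw [mul_sub, ← mul_assoc, one_div, inv_mul_cancel₀ two_ne_zero, one_mul, ← one_div]
    refine hlim.congr' ?_
    filter_upwards [hpow] with d hd
    rw [hd]

end Limits

end GNSLimit

end

/-! ### The two limits -/

theorem mainTheorem5 (n : ℕ) (hn : 1 ≤ n) (v : GNSLimit.Euc n → ℝ) (hv : GNSLimit.MemH1 v)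
    (hsupp : ∃ K : Set (GNSLimit.Euc n), IsCompact K ∧ ∀ᵐ x, x ∉ K → v x = 0) :
    -- the quantities below are well defined
    MemLp v 2 (GNSLimit.gauss n) ∧
    MemLp (GNSLimit.weakGradient v) 2 (GNSLimit.gauss n) ∧
    Integrable (GNSLimit.entropyDensity (GNSLimit.gauss n) v) (GNSLimit.gauss n) ∧
    (∀ᶠ d : ℕ in atTop, GNSLimit.MemSphereH1 (GNSLimit.liftToSphere v d) ∧
      Integrable (GNSLimit.entropyDensity (GNSLimit.unif d) (GNSLimit.liftToSphere v d))
        (GNSLimit.unif d)) ∧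
    -- the logarithmic Sobolev deficit
    Tendsto (fun d : ℕ => 1 / (d : ℝ) * GNSLimit.sphereLSIDeficit (GNSLimit.liftToSphere v d)) atTop
      (𝓝 (GNSLimit.gaussLSIDeficit v)) ∧
    -- the Gagliardo-Nirenberg-Sobolev deficit with exponents tending to `2`
    ∀ p : ℕ → ℝ,
      (∀ d : ℕ, 3 ≤ d → p d ∈ Set.Ioo (1 : ℝ) 2 ∪ Set.Ioo (2 : ℝ) (2 * d / (d - 2))) →
      Tendsto p atTop (𝓝 2) →
      (∀ᶠ d : ℕ in atTop,
        MemLp (GNSLimit.liftToSphere v d) (ENNReal.ofReal (p d)) (GNSLimit.unif d)) ∧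
      Tendsto (fun d : ℕ => 1 / (d : ℝ) * GNSLimit.sphereGNSDeficit (p d) (GNSLimit.liftToSphere v d))
        atTop (𝓝 (GNSLimit.gaussLSIDeficit v)) := by
  obtain ⟨K, hK, hKv⟩ := hsupp
  obtain ⟨R, hKR⟩ := hK.isBounded.subset_closedBall (0 : GNSLimit.Euc n)
  have hR : ∀ᵐ x, x ∉ Metric.closedBall (0 : GNSLimit.Euc n) R → v x = 0 := by
    filter_upwards [hKv] with x hx hxR using hx fun h => hxR (hKR h)
  obtain ⟨hg, hw⟩ := GNSLimit.weakGradient_spec hv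
  -- The exponent q > 2 serves both limits: it makes the entropies finite and dominates the
  -- quotients in p.
  obtain ⟨q, hq, hvq⟩ := GNSLimit.exists_memLp_gt_two hn hv.1 hg hw hR
  obtain ⟨C, hC, hle⟩ := GNSLimit.exists_map_scaledCoords_le n
  have hgrad := GNSLimit.tendsto_lpNorm_sphereWeakGradient hv hR
  have hlogG := memLp_one_iff_integrable.1 (GNSLimit.memLp_gauss
    (memLp_one_iff_integrable.2 (GNSLimit.integrable_sq_mul_log hv.1 hq hvq hR)))
  refine ⟨GNSLimit.memLp_gauss hv.1, GNSLimit.memLp_gauss hg,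
    (GNSLimit.entropy_eq (GNSLimit.memLp_gauss hv.1) hlogG).1, ?_, ?_, fun p hpm hp => ?_⟩
  · filter_upwards [hle, GNSLimit.eventually_memSphereH1 hv hR,
      GNSLimit.eventually_integrable_sq_mul_log hv.1 hq hvq hR] with d hd h1 h2
    exact ⟨h1.1, (GNSLimit.entropy_eq (GNSLimit.memLp_comp_scaledCoords hC hd hv.1) h2).1⟩
  · refine (hgrad.sub ((GNSLimit.tendsto_entropy hv.1 hq hvq hR).const_mul (1 / 2))).congr' ?_
    filter_upwards [eventually_ge_atTop 1] with d hd
    have hd0 : (d : ℝ) ≠ 0 := by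
      have : d ≠ 0 := by omega
      exact_mod_cast this
    rw [GNSLimit.sphereLSIDeficit]
    field_simp
  · have hp2 : ∀ᶠ d in atTop, p d ≠ 2 := by
      filter_upwards [eventually_ge_atTop 3] with d hd
      rcases hpm d hd with h | h
      · exact h.2.ne
      · exact h.1.ne'
    obtain ⟨hmem, hlim⟩ := GNSLimit.tendsto_lpNorm_sub_div hv.1 hq hvq hR hp hp2
    refine ⟨hmem, (hgrad.sub hlim).congr' ?_⟩
    filter_upwards [eventually_ge_atTop 1, hp2] with d hd hd2
    have hd0 : (d : ℝ) ≠ 0 := by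
      have : d ≠ 0 := by omega
      exact_mod_cast this
    have : 2 - p d ≠ 0 := sub_ne_zero.2 hd2.symm
    rw [GNSLimit.sphereGNSDeficit]
    field_simp
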